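/- Let $B_m$ be the Bernoulli numbers, $\frac{x}{e^x-1}=\sum_{m\ge 0}\frac{B_m}{m!}x^m$, let $S_k^{(1)}(l)$ be the (signed) Stirling numbers of the first kind, defined by $x(x+1)\cdots(x+k-1)=(-1)^k\sum_{l=0}^{k}(-1)^l S_k^{(1)}(l)\,x^l$, and let $\gamma_1=\lim_{m\to\infty}\bigl(\sum_{k=1}^{m}\frac{\log k}{k}-\frac12\log(m)^2\bigr)$ be the first Stieltjes constant. For every integer $n\ge 1$, both series below converge absolutely and $$\sum_{k=1}^{n}\frac{\log k}{k}=\frac12\log(n)^2+\frac{\log n}{2n}+\gamma_1+\sum_{k=1}^{\infty}\frac{(-1)^k\sum_{l=1}^{k}\frac{(-1)^l}{(l+1)!}B_{l+1}S_{l+1}^{(1)}(2)S_k^{(1)}(l)}{n(n+1)(n+2)\cdots(n+k)}+\log(n)\sum_{k=1}^{\infty}\frac{(-1)^k\sum_{l=1}^{k}\frac{1}{l+1}B_{l+1}S_k^{(1)}(l)}{n(n+1)(n+2)\cdots(n+k)}.$$ The numerators of the terms $k=1,2,3,4$ are $\frac1{12},\frac1{12},\frac{109}{720},\frac{49}{120}$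 in the first series and $-\frac1{12},-\frac1{12},-\frac{19}{120},-\frac{9}{20}$ in the second, i.e. $$\begin{aligned}\sum_{k=1}^{n}\frac{\log k}{k}&=\frac12\log(n)^2+\frac{\log n}{2n}+\gamma_1+\frac{1}{12n(n+1)}+\frac{1}{12n(n+1)(n+2)}+\frac{109}{720n(n+1)(n+2)(n+3)}+\frac{49}{120n(n+1)(n+2)(n+3)(n+4)}+\cdots\\&\quad-\frac{\log n}{12n(n+1)}-\frac{\log n}{12n(n+1)(n+2)}-\frac{19\log n}{120n(n+1)(n+2)(n+3)}-\frac{9\log n}{20n(n+1)(n+2)(n+3)(n+4)}-\cdots.\end{aligned}$$ -/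

import Mathlib

namespace SecondLogSum

open Filter Topology

/-- Signed Stirling numbers of the first kind `S_k^{(1)}(l)`, obtained from Mathlib's unsigned
ones. The identity that defines them is `pochhammer_eq_sum_stirlingS` below. -/
def stirlingS (k l : ℕ) : ℤ := (-1) ^ (k + l) * (Nat.stirlingFirst k l : ℤ)

theorem pochhammer_eq_sum_stirlingFirst {R : Type*} [CommRing R] (x : R) (k : ℕ) :
    (ascPochhammer R k).eval x =
      ∑ l ∈ Finset.range (k + 1), (Nat.stirlingFirst k l : R) * x ^ l := by
  induction k with
  | zero => simp
  | succ k ih =>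
    rw [ascPochhammer_succ_eval, ih, Finset.sum_range_succ' _ (k + 1)]
    simp only [Nat.stirlingFirst_succ_succ, Nat.stirlingFirst_succ_zero, Nat.cast_add, Nat.cast_mul,
      add_mul, Finset.sum_add_distrib, Nat.cast_zero, zero_mul, add_zero, mul_add]
    have h1 : ∑ l ∈ Finset.range (k + 1), (k : R) * (Nat.stirlingFirst k (l + 1) : R) * x ^ (l + 1)
        = (∑ l ∈ Finset.range (k + 1), (Nat.stirlingFirst k l : R) * x ^ l) * (k : R) := by
      have h2 := Finset.sum_range_succ' (fun l => (k : R) * (Nat.stirlingFirst k l : R) * x ^ l)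
        (k + 1)
      have h3 := Finset.sum_range_succ (fun l => (k : R) * (Nat.stirlingFirst k l : R) * x ^ l)
        (k + 1)
      have h4 : (k : R) * (Nat.stirlingFirst k 0 : R) = 0 := by
        cases k <;> simp
      rw [Nat.stirlingFirst_eq_zero_of_lt (Nat.lt_succ_self k)] at h3
      simp only [h4, Nat.cast_zero, mul_zero, zero_mul, add_zero] at h2 h3
      rw [← h2, h3, Finset.sum_mul]
      exact Finset.sum_congr rfl fun l _ => by ring
    have h5 : (∑ l ∈ Finset.range (k + 1), (Nat.stirlingFirst k l : R) * x ^ l) * x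
        = ∑ l ∈ Finset.range (k + 1), (Nat.stirlingFirst k l : R) * x ^ (l + 1) := by
      rw [Finset.sum_mul]
      exact Finset.sum_congr rfl fun l _ => by ring
    rw [h1, ← h5]
    ring

/-- The identity `(x)_k = (-1)^k ∑_{l=0}^k (-1)^l S_k^{(1)}(l) x^l`, where
`(x)_k = x (x+1) ⋯ (x+k-1)`. -/
theorem pochhammer_eq_sum_stirlingS {R : Type*} [CommRing R] (x : R) (k : ℕ) :
    (ascPochhammer R k).eval x =
      (-1) ^ k * ∑ l ∈ Finset.range (k + 1), (-1) ^ l * (stirlingS k l : R) * x ^ l := by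
  rw [pochhammer_eq_sum_stirlingFirst, Finset.mul_sum]
  refine Finset.sum_congr rfl fun l _ => ?_
  have hk : ((-1 : R) ^ k) * (-1) ^ k = 1 := by rw [← mul_pow]; simp
  have hl : ((-1 : R) ^ l) * (-1) ^ l = 1 := by rw [← mul_pow]; simp
  simp only [stirlingS, Int.cast_mul, Int.cast_pow, Int.cast_neg, Int.cast_one, Int.cast_natCast,
    pow_add]
  linear_combination (-(Nat.stirlingFirst k l : R) * x ^ l) * hk
    - (Nat.stirlingFirst k l : R) * x ^ l * ((-1 : R) ^ k * (-1) ^ k) * hl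

/-- The sequence `∑_{k=1}^m log k / k - (log m)^2 / 2`. -/
noncomputable def stieltjesOneSeq (m : ℕ) : ℝ :=
  (∑ k ∈ Finset.Icc 1 m, Real.log k / k) - Real.log m ^ 2 / 2

/-- The first Stieltjes constant `γ₁ = lim_{m → ∞} (∑_{k=1}^m log k / k - (log m)^2 / 2)`; the
limit exists by `tendsto_stieltjesOneSeq`. -/
noncomputable def stieltjesOne : ℝ := limUnder atTop stieltjesOneSeq

theorem integral_log_div {a b : ℝ} (ha : 0 < a) (hab : a ≤ b) :
    ∫ x in a..b, Real.log x / x = Real.log b ^ 2 / 2 - Real.log a ^ 2 / 2 := by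
  have hpos : ∀ x ∈ Set.uIcc a b, x ≠ 0 := by
    intro x hx
    rw [Set.uIcc_of_le hab] at hx
    exact (ha.trans_le hx.1).ne'
  refine intervalIntegral.integral_eq_sub_of_hasDerivAt
    (f := fun x => Real.log x ^ 2 / 2) (fun x hx => ?_) ?_
  · convert! ((Real.hasDerivAt_log (hpos x hx)).pow 2).div_const 2 using 1
    simp only [Nat.cast_ofNat, Nat.add_one_sub_one, pow_one]
    ring
  · refine ContinuousOn.intervalIntegrable ?_
    exact (Real.continuousOn_log.mono fun x hx => hpos x hx).div continuousOn_id hpos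

theorem antitoneOn_log_div (a b : ℕ) (ha : 3 ≤ a) :
    AntitoneOn (fun x : ℝ => Real.log x / x) (Set.Icc a b) := by
  refine Real.log_div_self_antitoneOn.mono fun x hx => ?_
  have h3 : (3 : ℝ) ≤ a := by exact_mod_cast ha
  exact (Real.exp_one_lt_three.le.trans h3).trans hx.1

theorem tendsto_stieltjesOneSeq : Tendsto stieltjesOneSeq atTop (𝓝 stieltjesOne) := by
  have hanti : Antitone fun m => stieltjesOneSeq (m + 3) := by
    refine antitone_nat_of_succ_le fun m => ?_
    have h := AntitoneOn.sum_le_integral_Ico (Nat.le_succ (m + 3))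
      (antitoneOn_log_div (m + 3) (m + 3 + 1) (by omega))
    rw [integral_log_div (by positivity) (by push_cast; linarith)] at h
    simp only [Nat.succ_eq_add_one, Nat.Ico_succ_singleton, Finset.sum_singleton] at h
    have e : m + 1 + 3 = m + 3 + 1 := by ring
    simp only [stieltjesOneSeq, e]
    rw [Finset.sum_Icc_succ_top (by omega)]
    linarith
  have hbdd : BddBelow (Set.range fun m => stieltjesOneSeq (m + 3)) := by
    refine ⟨-(Real.log 3 ^ 2 / 2), ?_⟩
    rintro _ ⟨m, rfl⟩
    have h := AntitoneOn.integral_le_sum_Ico (show 3 ≤ m + 3 by omega)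
      (antitoneOn_log_div 3 (m + 3) le_rfl)
    rw [integral_log_div (by positivity) (by push_cast; linarith [(Nat.cast_nonneg m : (0:ℝ) ≤ m)])]
      at h
    have hs : ∑ x ∈ Finset.Ico 3 (m + 3), Real.log (x : ℝ) / x
        ≤ ∑ k ∈ Finset.Icc 1 (m + 3), Real.log (k : ℝ) / k := by
      refine Finset.sum_le_sum_of_subset_of_nonneg (fun x hx => ?_) fun x _ _ => ?_
      · simp only [Finset.mem_Ico, Finset.mem_Icc] at hx ⊢
        omega
      · exact div_nonneg (Real.log_natCast_nonneg x) (Nat.cast_nonneg x)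
    simp only [stieltjesOneSeq]
    push_cast at h hs ⊢
    linarith
  have h := tendsto_atTop_ciInf hanti hbdd
  exact tendsto_nhds_limUnder ⟨_, (tendsto_add_atTop_iff_nat 3).1 h⟩

/-- `(-1)^k ∑_{l=1}^k (-1)^l / (l+1)! * B_{l+1} S_{l+1}^{(1)}(2) S_k^{(1)}(l)`
(`bernoulli` is the convention `B_1 = -1/2`). -/
noncomputable def coeffA (k : ℕ) : ℝ :=
  (-1) ^ k * ∑ l ∈ Finset.Icc 1 k, (-1) ^ l / ((l + 1).factorial : ℝ)
    * (bernoulli (l + 1) : ℝ) * (stirlingS (l + 1) 2 : ℝ) * (stirlingS k l : ℝ)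

/-- `(-1)^k ∑_{l=1}^k 1 / (l+1) * B_{l+1} S_k^{(1)}(l)`. -/
noncomputable def coeffB (k : ℕ) : ℝ :=
  (-1) ^ k * ∑ l ∈ Finset.Icc 1 k, 1 / ((l : ℝ) + 1)
    * (bernoulli (l + 1) : ℝ) * (stirlingS k l : ℝ)

/-- The product `n (n+1) (n+2) ⋯ (n+k)`. -/
noncomputable def risingProd (n k : ℕ) : ℝ := ∏ i ∈ Finset.range (k + 1), ((n : ℝ) + i)

end SecondLogSum

namespace SecondLogSum

open Filter Topology MeasureTheory Set

/-! The proof applies the Abel–Plana formula to `log z / z` and expands the integrand of the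
correction term in an inverse factorial series.

Write `w(s) = 2/(exp(2πs) - 1)`, let `R(n)` be the integral of `w(s) Im f(n + is)` over `s > 0` with
`f(z) = log z / z`, and let `H_l` be the harmonic numbers. Cauchy's theorem on a half-strip of width
one (`integral_strip`) identifies `R(n) - R(n+1)` with the integral of `f` over `[n, n+1]` minus its
trapezoidal value. Since `R(n) → 0`, telescoping gives `∑_{k≤n} log k / k - (log n)²/2 = log n/(2n)
+ γ₁ + R(n)` (`stieltjesOneSeq_eq`).

Put `x = is` and `(x)_k = x(x+1)⋯(x+k-1)`. Conjugation turns `Im f(n + is)` into the imaginary part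
of `(log n - log(n-x))/(n-x)` minus `log n` times that of `1/(n-x)` (`im_log_div_eq`). A telescoping
sum shows `1/(n-x) = ∑ (x)_k / (n(n+1)⋯(n+k))`. The operator `x^l ↦ H_l x^l` sends the geometric
series of `1/(n-x)` to that of `(log n - log(n-x))/(n-x)`, so the latter should have the same
expansion with `(x)_k` replaced by `harmonicPochhammer k x`. The proof of this uses a recursion with
explicit remainders, not power series.

Integrating term by term yields the coefficients, because `w` has moments `∫ Im((is)^l) w(s) ds =
B_{l+1}/(l+1)` for `l ≥ 1`, again by the half-strip formula, now for Bernoulli polynomials, and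
because `|S_{l+1}^{(1)}(2)| = l! H_l`. The interchange rests on a bound of order `j! √(j+1)
exp(πs/2)`, up to a polynomial in `s`, for both families at index `j+1`. The weight absorbs the
exponential, and `(j+2)!` in the denominator leaves `O(j^{-3/2})`. -/

/-! ### The Abel–Plana formula on a half-strip of width one. -/

/-- The Abel–Plana weight `2 / (exp (2πs) - 1)`. -/
noncomputable def abelWeight (s : ℝ) : ℝ := 2 / (Real.exp (2 * Real.pi * s) - 1)

theorem tendsto_div_of_hasDerivAt_of_eq_zero {h e : ℂ → ℂ} {h' e' z : ℂ} (hh : HasDerivAt h h' z)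
    (he : HasDerivAt e e' z) (h0 : h z = 0) (e0 : e z = 0) (he' : e' ≠ 0) :
    Tendsto (fun w => h w / e w) (𝓝[≠] z) (𝓝 (h' / e')) := by
  have h1 := (hasDerivAt_iff_tendsto_slope.1 hh).div (hasDerivAt_iff_tendsto_slope.1 he) he'
  refine h1.congr' ?_
  filter_upwards [self_mem_nhdsWithin] with w hw
  have hw' : w - z ≠ 0 := sub_ne_zero.2 hw
  simp only [Pi.div_apply, slope_def_field, h0, e0, sub_zero]
  field_simp

/-- The function `exp (-2πiz) - 1`. -/
noncomputable def expSubOne (z : ℂ) : ℂ := Complex.exp (-(2 * Real.pi * Complex.I) * z) - 1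

theorem hasDerivAt_expSubOne (z : ℂ) :
    HasDerivAt expSubOne
      (Complex.exp (-(2 * Real.pi * Complex.I) * z) * -(2 * Real.pi * Complex.I)) z := by
  have h := ((hasDerivAt_id z).const_mul (-(2 * Real.pi * Complex.I))).cexp.sub_const 1
  convert! h using 1
  simp

theorem expSubOne_eq_zero_iff {z : ℂ} : expSubOne z = 0 ↔ ∃ m : ℤ, z = m := by
  rw [expSubOne, sub_eq_zero, Complex.exp_eq_one_iff]
  have hpi := Complex.two_pi_I_ne_zero
  constructor
  · rintro ⟨m, hm⟩
    refine ⟨-m, mul_right_cancel₀ hpi ?_⟩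
    push_cast
    linear_combination -hm
  · rintro ⟨m, rfl⟩
    exact ⟨-m, by push_cast; ring⟩

theorem expSubOne_ne_zero_of_im_pos {z : ℂ} (hz : 0 < z.im) : expSubOne z ≠ 0 := by
  intro h
  obtain ⟨m, rfl⟩ := expSubOne_eq_zero_iff.1 h
  simp at hz

/-- By periodicity the kernel is real on the vertical sides, where it becomes the denominator of the
Abel–Plana weight. -/
theorem expSubOne_natCast_add_mul_I (m : ℕ) (s : ℝ) :
    expSubOne (m + s * Complex.I) = ((Real.exp (2 * Real.pi * s) - 1 : ℝ) : ℂ) := by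
  have h : -(2 * Real.pi * Complex.I) * (m + s * Complex.I)
      = ((2 * Real.pi * s : ℝ) : ℂ) + ((-m : ℤ) : ℂ) * (2 * Real.pi * Complex.I) := by
    push_cast
    linear_combination (-2 * (Real.pi : ℂ) * s) * Complex.I_sq
  rw [expSubOne, h, Complex.exp_periodic.int_mul]
  push_cast
  rfl

theorem exp_two_mul_le_norm_expSubOne {z : ℂ} (hz : 1 ≤ z.im) :
    Real.exp (2 * z.im) ≤ ‖expSubOne z‖ := by
  have h1 := norm_sub_norm_le (Complex.exp (-(2 * Real.pi * Complex.I) * z)) 1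
  have h2 : ‖Complex.exp (-(2 * Real.pi * Complex.I) * z)‖ = Real.exp (2 * Real.pi * z.im) := by
    rw [Complex.norm_exp]; simp
  -- Since `2π > 3`, one spare factor `exp (z.im) ≥ 1 + z.im` absorbs the subtracted `1`.
  have h3 : Real.exp (2 * z.im + z.im) ≤ Real.exp (2 * Real.pi * z.im) := by
    apply Real.exp_le_exp.2
    nlinarith [Real.pi_gt_three]
  rw [Real.exp_add] at h3
  have h4 := Real.add_one_le_exp z.im
  have h5 : 1 ≤ Real.exp (2 * z.im) := Real.one_le_exp (by linarith)
  rw [h2, norm_one] at h1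
  simp only [expSubOne]
  nlinarith

/-- With `θ = 2πx`, `1/(exp(-iθ) - 1) = -1/2 + (i/2) cot(θ/2)`. The constant real part is what
produces the plain integral along the bottom side. -/
theorem div_expSubOne_re {x : ℝ} (hx : expSubOne x ≠ 0) {w : ℂ} (hw : w.im = 0) :
    (w / expSubOne x).re = -(1 / 2) * w.re := by
  have he : expSubOne x = ⟨Real.cos (2 * Real.pi * x) - 1, -Real.sin (2 * Real.pi * x)⟩ := by
    have : -(2 * Real.pi * Complex.I) * x = ((-(2 * Real.pi * x) : ℝ) : ℂ) * Complex.I := by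
      push_cast; ring
    rw [expSubOne, this]
    apply Complex.ext
    · rw [Complex.sub_re, Complex.exp_ofReal_mul_I_re, Real.cos_neg, Complex.one_re]
    · rw [Complex.sub_im, Complex.exp_ofReal_mul_I_im, Real.sin_neg, Complex.one_im, sub_zero]
  have hn : Complex.normSq (expSubOne x) = 2 - 2 * Real.cos (2 * Real.pi * x) := by
    rw [he, Complex.normSq_mk]
    nlinarith [Real.sin_sq_add_cos_sq (2 * Real.pi * x)]
  have hn0 : Complex.normSq (expSubOne x) ≠ 0 := by simpa using hx
  rw [Complex.div_re, hw, zero_mul, zero_div, add_zero, hn]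
  rw [hn] at hn0
  rw [he, eq_comm, eq_div_iff hn0]
  ring

open Classical in
/-- The quotient `h / (exp (-2πiz) - 1)`, extended over removable singularities. -/
noncomputable def abelQuotient (h : ℂ → ℂ) (z : ℂ) : ℂ :=
  if expSubOne z = 0 then deriv h z / deriv expSubOne z else h z / expSubOne z

theorem abelQuotient_of_ne {h : ℂ → ℂ} {z : ℂ} (hz : expSubOne z ≠ 0) :
    abelQuotient h z = h z / expSubOne z := if_neg hz

theorem abelQuotient_eventuallyEq {h : ℂ → ℂ} {z : ℂ} (hz : expSubOne z ≠ 0) :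
    abelQuotient h =ᶠ[𝓝 z] fun w => h w / expSubOne w := by
  filter_upwards [(hasDerivAt_expSubOne z).continuousAt.eventually_ne hz] with w hw
  exact abelQuotient_of_ne hw

theorem differentiableAt_abelQuotient {h : ℂ → ℂ} {z : ℂ} (hh : DifferentiableAt ℂ h z)
    (hz : expSubOne z ≠ 0) : DifferentiableAt ℂ (abelQuotient h) z :=
  (hh.div (hasDerivAt_expSubOne z).differentiableAt hz).congr_of_eventuallyEq
    (abelQuotient_eventuallyEq hz)

/-- The zeros of the kernel are simple, so a zero of `h` there makes the singularity removable.
Continuity suffices, because the rectangle theorem asks for differentiability only in the open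
rectangle. -/
theorem continuousAt_abelQuotient {h : ℂ → ℂ} {z : ℂ} (hh : DifferentiableAt ℂ h z)
    (h0 : expSubOne z = 0 → h z = 0) : ContinuousAt (abelQuotient h) z := by
  by_cases hz : expSubOne z = 0
  · have he' : deriv expSubOne z ≠ 0 := by
      rw [(hasDerivAt_expSubOne z).deriv]
      exact mul_ne_zero (Complex.exp_ne_zero _) (neg_ne_zero.2 Complex.two_pi_I_ne_zero)
    have hed := (hasDerivAt_expSubOne z).differentiableAt.hasDerivAt
    rw [continuousAt_iff_punctured_nhds]
    have hq : abelQuotient h z = deriv h z / deriv expSubOne z := if_pos hz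
    rw [hq]
    refine (tendsto_div_of_hasDerivAt_of_eq_zero hh.hasDerivAt hed (h0 hz) hz he').congr' ?_
    filter_upwards [hed.eventually_ne he'] with w hw
    exact (abelQuotient_of_ne (by simpa [hz] using hw)).symm
  · exact (differentiableAt_abelQuotient hh hz).continuousAt

section Strip

variable {h : ℂ → ℂ} {C : ℝ}

theorem eq_zero_of_expSubOne_eq_zero (h0 : h 0 = 0) (h1 : h 1 = 0) {z : ℂ} (hz0 : 0 ≤ z.re)
    (hz1 : z.re ≤ 1) (hz : expSubOne z = 0) : h z = 0 := by
  obtain ⟨m, rfl⟩ := expSubOne_eq_zero_iff.1 hz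
  simp only [Complex.intCast_re] at hz0 hz1
  have hm0 : 0 ≤ m := by exact_mod_cast hz0
  have hm1 : m ≤ 1 := by exact_mod_cast hz1
  obtain rfl | rfl : m = 0 ∨ m = 1 := by omega
  · simpa using h0
  · simpa using h1

theorem norm_abelQuotient_le (hC : ∀ z : ℂ, 0 ≤ z.re → z.re ≤ 1 → 0 ≤ z.im →
      ‖h z‖ ≤ C * Real.exp z.im) {z : ℂ} (hz0 : 0 ≤ z.re) (hz1 : z.re ≤ 1) (hz : 1 ≤ z.im) :
    ‖abelQuotient h z‖ ≤ C * Real.exp (-z.im) := by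
  have hE := exp_two_mul_le_norm_expSubOne hz
  have hC' := hC z hz0 hz1 (by linarith)
  have h2 : Real.exp (2 * z.im) = Real.exp z.im * Real.exp z.im := by rw [← Real.exp_add]; ring_nf
  rw [abelQuotient_of_ne (expSubOne_ne_zero_of_im_pos (by linarith)), norm_div]
  calc ‖h z‖ / ‖expSubOne z‖ ≤ (C * Real.exp z.im) / Real.exp (2 * z.im) :=
        div_le_div₀ ((norm_nonneg _).trans hC') hC' (Real.exp_pos _) hE
    _ = C * Real.exp (-z.im) := by
        rw [h2, Real.exp_neg]
        field_simp

theorem integrableOn_abelQuotient_im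
    (hd : ∀ z : ℂ, 0 ≤ z.re → z.re ≤ 1 → 0 ≤ z.im → DifferentiableAt ℂ h z)
    (hC : ∀ z : ℂ, 0 ≤ z.re → z.re ≤ 1 → 0 ≤ z.im → ‖h z‖ ≤ C * Real.exp z.im)
    (h0 : h 0 = 0) (h1 : h 1 = 0) {x : ℝ} (hx0 : 0 ≤ x) (hx1 : x ≤ 1) :
    IntegrableOn (fun s : ℝ => (abelQuotient h (x + s * Complex.I)).im) (Ioi 0) := by
  refine integrable_of_isBigO_exp_neg one_pos (fun s hs => ?_) ?_
  · have hs' : (0 : ℝ) ≤ s := hs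
    have hz : ContinuousAt (abelQuotient h) ((x : ℂ) + s * Complex.I) :=
      continuousAt_abelQuotient (hd _ (by simpa) (by simpa) (by simpa))
        (eq_zero_of_expSubOne_eq_zero h0 h1 (by simpa) (by simpa))
    exact (Complex.continuous_im.continuousAt.comp
      (ContinuousAt.comp (f := fun s : ℝ => (x : ℂ) + s * Complex.I) hz
      (by fun_prop))).continuousWithinAt
  · refine Asymptotics.IsBigO.of_bound C ?_
    filter_upwards [eventually_ge_atTop (1 : ℝ)] with s hs
    have := norm_abelQuotient_le hC (z := x + s * Complex.I) (by simpa) (by simpa) (by simpa)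
    have h3 := Complex.abs_im_le_norm (abelQuotient h (x + s * Complex.I))
    simpa using h3.trans this

theorem abelQuotient_natCast_im (m : ℕ) {s : ℝ} (hs : 0 < s) :
    (abelQuotient h (m + s * Complex.I)).im = 1 / 2 * ((h (m + s * Complex.I)).im * abelWeight s)
    := by
  rw [abelQuotient_of_ne (expSubOne_ne_zero_of_im_pos (by simpa)), expSubOne_natCast_add_mul_I,
    Complex.div_ofReal_im, abelWeight]
  ring

/-- Cauchy's theorem for `h / (exp(-2πiz) - 1)` on the rectangle `[0,1] × [0,T]`, in real parts. The
vertical sides contribute imaginary parts against half the weight, the bottom gives `-1/2` times the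
integral of `h`, and the top vanishes as `T → ∞`. The zeros of `h` at the corners remove the poles
there. -/
theorem integral_strip_of_eq_zero
    (hd : ∀ z : ℂ, 0 ≤ z.re → z.re ≤ 1 → 0 ≤ z.im → DifferentiableAt ℂ h z)
    (hC : ∀ z : ℂ, 0 ≤ z.re → z.re ≤ 1 → 0 ≤ z.im → ‖h z‖ ≤ C * Real.exp z.im)
    (hr : ∀ x : ℝ, 0 ≤ x → x ≤ 1 → (h x).im = 0) (h0 : h 0 = 0) (h1 : h 1 = 0) :
    ∫ s in Ioi (0 : ℝ), ((h (s * Complex.I)).im - (h (1 + s * Complex.I)).im) * abelWeight s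
      = ∫ x in (0 : ℝ)..1, (h x).re := by
  set q := abelQuotient h with hq
  have hrect : ∀ T : ℝ, 0 < T →
      (∫ s in (0 : ℝ)..T, (q ((0 : ℝ) + s * Complex.I)).im)
        - (∫ s in (0 : ℝ)..T, (q ((1 : ℝ) + s * Complex.I)).im)
        = 1 / 2 * (∫ x in (0 : ℝ)..1, (h x).re)
          + (∫ x in (0 : ℝ)..1, q (x + T * Complex.I)).re := by
    intro T hT
    have hcont : ∀ z : ℂ, 0 ≤ z.re → z.re ≤ 1 → 0 ≤ z.im → ContinuousAt q z := fun z a b c =>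
      continuousAt_abelQuotient (hd z a b c) (eq_zero_of_expSubOne_eq_zero h0 h1 a b)
    have key := Complex.integral_boundary_rect_eq_zero_of_continuousOn_of_differentiableOn q 0
      (1 + T * Complex.I) (fun z hz => ?_) (fun z hz => ?_)
    · have hside : ∀ c : ℝ, 0 ≤ c → c ≤ 1 →
          IntervalIntegrable (fun s : ℝ => q (c + s * Complex.I)) volume 0 T := by
        intro c hc0 hc1
        refine ContinuousOn.intervalIntegrable fun s hs => ?_
        rw [uIcc_of_le hT.le] at hs
        exact (ContinuousAt.comp (f := fun s : ℝ => (c : ℂ) + s * Complex.I)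
          (hcont _ (by simpa) (by simpa) (by simpa using hs.1))
          (by fun_prop)).continuousWithinAt
      have hbot : IntervalIntegrable (fun x : ℝ => q x) volume 0 1 := by
        refine ContinuousOn.intervalIntegrable fun x hx => ?_
        rw [uIcc_of_le zero_le_one] at hx
        exact (ContinuousAt.comp (f := fun x : ℝ => (x : ℂ))
          (hcont _ (by simpa using hx.1) (by simpa using hx.2) (by simp))
          (by fun_prop)).continuousWithinAt
      have him : ∀ c : ℝ, 0 ≤ c → c ≤ 1 → (∫ s in (0 : ℝ)..T, q (c + s * Complex.I)).im
          = ∫ s in (0 : ℝ)..T, (q (c + s * Complex.I)).im := fun c hc0 hc1 =>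
        (Complex.imCLM.intervalIntegral_comp_comm (hside c hc0 hc1)).symm
      have hbre : (∫ x in (0 : ℝ)..1, q x).re = -(1 / 2) * ∫ x in (0 : ℝ)..1, (h x).re := by
        have h2 : (∫ x in (0 : ℝ)..1, q x).re = ∫ x in (0 : ℝ)..1, (q x).re :=
          (Complex.reCLM.intervalIntegral_comp_comm hbot).symm
        rw [h2, ← intervalIntegral.integral_const_mul]
        refine intervalIntegral.integral_congr_Ioo_of_le zero_le_one fun x hx => ?_
        have hx' : expSubOne x ≠ 0 := by
          intro he
          obtain ⟨m, hm⟩ := expSubOne_eq_zero_iff.1 he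
          have hm' : x = m := by exact_mod_cast hm
          rw [hm'] at hx
          have h3 : 0 < m := by exact_mod_cast hx.1
          have h4 : m < 1 := by exact_mod_cast hx.2
          omega
        change (abelQuotient h x).re = _
        rw [abelQuotient_of_ne hx', div_expSubOne_re hx' (hr x hx.1.le hx.2.le)]
      have hre := congrArg Complex.re key
      simp only [Complex.zero_re, Complex.add_re, Complex.one_re, Complex.mul_re, Complex.ofReal_re,
        Complex.I_re, mul_zero, Complex.ofReal_im, Complex.I_im, mul_one, sub_self, add_zero,
        Complex.zero_im, Complex.ofReal_zero, zero_mul, Complex.add_im, Complex.one_im,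
        Complex.mul_im, zero_add, smul_eq_mul, Complex.sub_re, one_mul] at hre
      have i0 := him 0 le_rfl zero_le_one
      have i1 := him 1 zero_le_one le_rfl
      simp only [Complex.ofReal_zero, zero_add] at i0 i1 ⊢
      rw [hbre, i0, i1] at hre
      linarith
    · rw [Complex.mem_reProdIm] at hz
      simp [uIcc_of_le hT.le] at hz
      exact (hcont z hz.1.1 hz.1.2 hz.2.1).continuousWithinAt
    · rw [Complex.mem_reProdIm] at hz
      simp [hT.le] at hz
      exact (differentiableAt_abelQuotient (hd z hz.1.1.le hz.1.2.le hz.2.1.le)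
        (expSubOne_ne_zero_of_im_pos hz.2.1)).differentiableWithinAt
  have htop : Tendsto (fun T : ℝ => (∫ x in (0 : ℝ)..1, q (x + T * Complex.I)).re) atTop (𝓝 0) := by
    have hb : Tendsto (fun T : ℝ => C * Real.exp (-T)) atTop (𝓝 0) := by
      simpa using (Real.tendsto_exp_neg_atTop_nhds_zero).const_mul C
    refine squeeze_zero_norm' ?_ hb
    filter_upwards [eventually_ge_atTop (1 : ℝ)] with T hT
    refine (Complex.abs_re_le_norm _).trans ?_
    refine (intervalIntegral.norm_integral_le_of_norm_le_const (C := C * Real.exp (-T))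
      fun x hx => ?_).trans (by simp)
    rw [uIoc_of_le zero_le_one] at hx
    simpa using norm_abelQuotient_le hC (z := x + T * Complex.I) (by simpa using hx.1.le)
      (by simpa using hx.2) (by simpa using hT)
  have hI0 := integrableOn_abelQuotient_im hd hC h0 h1 (x := 0) le_rfl zero_le_one
  have hI1 := integrableOn_abelQuotient_im hd hC h0 h1 (x := 1) zero_le_one le_rfl
  have hl0 := intervalIntegral_tendsto_integral_Ioi 0 hI0 tendsto_id
  have hl1 := intervalIntegral_tendsto_integral_Ioi 0 hI1 tendsto_id
  have hlim := tendsto_nhds_unique_of_eventuallyEq (hl0.sub hl1)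
    (htop.const_add (1 / 2 * (∫ x in (0 : ℝ)..1, (h x).re)))
    ((eventually_gt_atTop 0).mono fun T hT => hrect T hT)
  rw [← integral_sub hI0 hI1, add_zero] at hlim
  have hcongr : ∫ s in Ioi (0 : ℝ), ((abelQuotient h ((0 : ℝ) + s * Complex.I)).im
      - (abelQuotient h ((1 : ℝ) + s * Complex.I)).im)
      = ∫ s in Ioi (0 : ℝ), 1 / 2 *
        (((h (s * Complex.I)).im - (h (1 + s * Complex.I)).im) * abelWeight s) := by
    refine setIntegral_congr_fun measurableSet_Ioi fun s hs => ?_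
    have e0 := abelQuotient_natCast_im (h := h) 0 hs
    have e1 := abelQuotient_natCast_im (h := h) 1 hs
    simp only [Nat.cast_zero, Nat.cast_one] at e0 e1
    simp only [Complex.ofReal_zero, Complex.ofReal_one, zero_add] at e0 ⊢
    rw [e0, e1]
    ring
  rw [hcongr, integral_const_mul] at hlim
  linarith

end Strip

/-- The difference of the trapezoidal rule and the integral over one step, as an integral over the
two vertical sides of a half-strip. -/
theorem integral_strip {f : ℂ → ℂ} {a C : ℝ}
    (hd : ∀ z : ℂ, a ≤ z.re → z.re ≤ a + 1 → 0 ≤ z.im → DifferentiableAt ℂ f z)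
    (hC : ∀ z : ℂ, a ≤ z.re → z.re ≤ a + 1 → 0 ≤ z.im → ‖f z‖ ≤ C * Real.exp z.im)
    (hr : ∀ x : ℝ, a ≤ x → x ≤ a + 1 → (f x).im = 0) :
    ∫ s in Ioi (0 : ℝ), ((f (a + s * Complex.I)).im - (f (a + 1 + s * Complex.I)).im)
        * abelWeight s
      = (∫ x in a..(a + 1), (f x).re) - ((f a).re + (f (a + 1)).re) / 2 := by
  -- Subtracting the chord makes `f` vanish at both corners. The chord is real on the real axis and
  -- its slope `d` is real, so its imaginary parts on the two sides cancel, while its integral is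
  -- the trapezoidal term.
  set d : ℂ := f (a + 1) - f a with hdd
  have ra : (f a).im = 0 := hr a le_rfl (by linarith)
  have rb : (f (a + 1)).im = 0 := by
    have := hr (a + 1) (by linarith) le_rfl
    simpa using this
  have rd : d.im = 0 := by rw [hdd, Complex.sub_im, ra, rb, sub_zero]
  have key := integral_strip_of_eq_zero (h := fun z => f (a + z) - f a - d * z)
    (C := C + ‖f a‖ + ‖d‖) (fun z h0 h1 h2 => ?_) (fun z h0 h1 h2 => ?_) (fun x h0 h1 => ?_)
    (by simp) (by simp [hdd])
  · have hint : ∫ x in (0 : ℝ)..1, (f (a + x) - f a - d * x).re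
        = (∫ x in a..(a + 1), (f x).re) - ((f a).re + (f (a + 1)).re) / 2 := by
      have hc : IntervalIntegrable (fun x : ℝ => (f (a + x)).re) volume 0 1 := by
        refine ContinuousOn.intervalIntegrable fun x hx => ?_
        rw [uIcc_of_le zero_le_one] at hx
        exact (Complex.continuous_re.continuousAt.comp
          (ContinuousAt.comp (f := fun x : ℝ => (a : ℂ) + x)
            (hd _ (by simpa using hx.1) (by simpa using hx.2) (by simp)).continuousAt
            (by fun_prop))).continuousWithinAt
      have hs := intervalIntegral.integral_comp_add_left (a := 0) (b := 1)
        (fun x : ℝ => (f x).re) a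
      simp only [Complex.ofReal_add, add_zero] at hs
      simp only [Complex.sub_re, Complex.re_mul_ofReal]
      rw [intervalIntegral.integral_sub (hc.sub (by simp))
          (Continuous.intervalIntegrable (by fun_prop) _ _),
        intervalIntegral.integral_sub hc (by simp), hs, intervalIntegral.integral_const_mul,
        integral_id, hdd]
      simp
      ring
    rw [← hint, ← key]
    refine integral_congr_ae (ae_of_all _ fun s => ?_)
    simp only [Complex.sub_im, Complex.mul_im, rd, ra]
    simp [add_assoc]
  · refine ((DifferentiableAt.comp (f := fun z => (a : ℂ) + z) z
      (hd _ (by simpa) (by simpa) (by simpa)) (by fun_prop)).sub_const _).sub (by fun_prop)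
  · have e1 := hC (a + z) (by simpa) (by simpa) (by simpa)
    have e2 : ‖z‖ ≤ Real.exp z.im := by
      have := Complex.norm_le_abs_re_add_abs_im z
      rw [abs_of_nonneg h0, abs_of_nonneg h2] at this
      linarith [Real.add_one_le_exp z.im]
    have e3 : 1 ≤ Real.exp z.im := Real.one_le_exp h2
    have e4 : ‖f (a + z) - f a - d * z‖ ≤ ‖f (a + z)‖ + ‖f a‖ + ‖d‖ * ‖z‖ := by
      rw [← norm_mul]
      exact (norm_sub_le _ _).trans (by gcongr; exact norm_sub_le _ _)
    simp at e1
    refine e4.trans ?_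
    nlinarith [norm_nonneg (f a), norm_nonneg d, mul_le_mul_of_nonneg_left e2 (norm_nonneg d),
      mul_le_mul_of_nonneg_left e3 (norm_nonneg (f a))]
  · have := hr (a + x) (by linarith) (by linarith)
    simp only [Complex.ofReal_add] at this
    simp [this, ra, rd]

/-! ### Moments of the weight and Bernoulli numbers. -/

theorem exists_norm_eval_le_exp (p : Polynomial ℂ) :
    ∃ C : ℝ, ∀ z : ℂ, 0 ≤ z.re → z.re ≤ 1 → 0 ≤ z.im → ‖p.eval z‖ ≤ C * Real.exp z.im := by
  induction p using Polynomial.induction_on' with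
  | add p q hp hq =>
    obtain ⟨C, hC⟩ := hp
    obtain ⟨D, hD⟩ := hq
    refine ⟨C + D, fun z h0 h1 h2 => ?_⟩
    rw [Polynomial.eval_add, add_mul]
    exact (norm_add_le _ _).trans (add_le_add (hC z h0 h1 h2) (hD z h0 h1 h2))
  | monomial n c =>
    refine ⟨‖c‖ * (n.factorial * Real.exp 1), fun z h0 h1 h2 => ?_⟩
    have e1 : ‖z‖ ≤ 1 + z.im := by
      have := Complex.norm_le_abs_re_add_abs_im z
      rw [abs_of_nonneg h0, abs_of_nonneg h2] at this
      linarith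
    have e2 := Real.pow_div_factorial_le_exp (1 + z.im) (by linarith) n
    rw [div_le_iff₀ (by positivity), Real.exp_add] at e2
    rw [Polynomial.eval_monomial, norm_mul, norm_pow, mul_assoc]
    gcongr
    calc ‖z‖ ^ n ≤ (1 + z.im) ^ n := by gcongr
      _ ≤ _ := e2
      _ = _ := by ring

/-- The moments of the Abel–Plana weight. -/
theorem integral_im_pow_mul_abelWeight (l : ℕ) (hl : l ≠ 0) :
    ∫ s in Ioi (0 : ℝ), ((s * Complex.I) ^ l).im * abelWeight s
      = (bernoulli (l + 1) : ℝ) / (l + 1) := by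
  set p : Polynomial ℂ := (Polynomial.bernoulli (l + 1)).map (algebraMap ℚ ℂ) with hp
  obtain ⟨C, hC⟩ := exists_norm_eval_le_exp p
  have hreal : ∀ x : ℝ, p.eval (x : ℂ) = (bernoulliFun (l + 1) x : ℂ) := by
    intro x
    have : p = ((Polynomial.bernoulli (l + 1)).map (algebraMap ℚ ℝ)).map Complex.ofRealHom := by
      rw [hp, Polynomial.map_map]
      congr 1
    rw [this, bernoulliFun]
    exact Polynomial.eval_map_apply Complex.ofRealHom x
  have hshift : ∀ z : ℂ, p.eval (1 + z) = p.eval z + (l + 1) * z ^ l := by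
    intro z
    have h := congrArg (fun q : Polynomial ℚ => (q.map (algebraMap ℚ ℂ)).eval z)
      (Polynomial.bernoulli_comp_one_add_X (l + 1))
    simpa [Polynomial.map_comp, hp] using h
  -- For `f = B_{l+1}(z)` the difference across the strip is `(l+1) z^l`, the integral over `[0,1]`
  -- is zero, and both endpoint values equal `B_{l+1}`, since `l ≠ 0`.
  have key := integral_strip (f := fun z => p.eval z) (a := 0) (C := C)
    (fun z _ _ _ => p.differentiable.differentiableAt)
    (fun z h0 h1 h2 => hC z h0 (by simpa using h1) h2) (fun x _ _ => by rw [hreal]; simp)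
  have h1 : p.eval 1 = (bernoulliFun (l + 1) 1 : ℂ) := by simpa using hreal 1
  have h0 : p.eval 0 = (bernoulliFun (l + 1) 0 : ℂ) := by simpa using hreal 0
  simp only [hreal, Complex.ofReal_re, Complex.ofReal_zero, zero_add, hshift, h0, h1,
    integral_bernoulliFun_eq_zero (Nat.succ_ne_zero l),
    bernoulliFun_endpoints_eq_of_ne_one (show l + 1 ≠ 1 by omega), bernoulliFun_eval_zero] at key
  have hcongr : ∫ s in Ioi (0 : ℝ), ((p.eval (s * Complex.I)).im
      - (p.eval (s * Complex.I) + (l + 1) * (s * Complex.I) ^ l).im) * abelWeight s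
      = -(l + 1) * ∫ s in Ioi (0 : ℝ), ((s * Complex.I) ^ l).im * abelWeight s := by
    rw [← integral_const_mul]
    refine integral_congr_ae (ae_of_all _ fun s => ?_)
    have : (((l : ℂ) + 1) * (s * Complex.I) ^ l).im = (l + 1) * ((s * Complex.I) ^ l).im := by
      rw [show ((l : ℂ) + 1) = ((l + 1 : ℝ) : ℂ) by push_cast; rfl, Complex.im_ofReal_mul]
    simp only [Complex.add_im, this]
    ring
  rw [hcongr] at key
  have : (0 : ℝ) < l + 1 := by positivity
  rw [eq_div_iff this.ne']
  linarith

/-! ### Rising factorials with harmonic weights. -/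

theorem stirlingFirst_succ_two (l : ℕ) :
    (Nat.stirlingFirst (l + 1) 2 : ℚ) = l.factorial * harmonic l := by
  induction l with
  | zero => simp [Nat.stirlingFirst]
  | succ l ih =>
    rw [Nat.stirlingFirst_succ_succ, Nat.cast_add, Nat.cast_mul, ih, Nat.stirlingFirst_one_right,
      harmonic_succ, Nat.factorial_succ]
    have : ((l + 1 : ℕ) : ℚ) ≠ 0 := by positivity
    push_cast at this ⊢
    field_simp

/-- The polynomial `x (x+1) ⋯ (x+k-1)` with its coefficients multiplied by harmonic numbers. -/
noncomputable def harmonicPochhammer (k : ℕ) (x : ℂ) : ℂ :=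
  ∑ l ∈ Finset.range (k + 1), (harmonic l : ℂ) * (Nat.stirlingFirst k l : ℂ) * x ^ l

theorem harmonicPochhammer_zero (x : ℂ) : harmonicPochhammer 0 x = 0 := by
  simp [harmonicPochhammer]

theorem harmonicPochhammer_one (x : ℂ) : harmonicPochhammer 1 x = x := by
  simp [harmonicPochhammer, Finset.sum_range_succ, Nat.stirlingFirst_self]

theorem I_mul_integral_ascPochhammer (k : ℕ) (s : ℝ) :
    Complex.I * ∫ τ in (0 : ℝ)..s, (ascPochhammer ℂ k).eval (τ * Complex.I)
      = ∑ l ∈ Finset.range (k + 1),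
        (Nat.stirlingFirst k l : ℂ) * ((s * Complex.I) ^ (l + 1) / (l + 1)) := by
  simp only [pochhammer_eq_sum_stirlingFirst]
  rw [intervalIntegral.integral_finsetSum
    (fun l _ => Continuous.intervalIntegrable (by fun_prop) _ _), Finset.mul_sum]
  refine Finset.sum_congr rfl fun l _ => ?_
  have h : ∀ τ : ℝ, (Nat.stirlingFirst k l : ℂ) * (τ * Complex.I) ^ l
      = (Nat.stirlingFirst k l * Complex.I ^ l) * ((τ ^ l : ℝ) : ℂ) := by
    intro τ; push_cast; ring
  simp only [h]
  rw [intervalIntegral.integral_const_mul, intervalIntegral.integral_ofReal, integral_pow]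
  push_cast
  rw [zero_pow (Nat.succ_ne_zero l)]
  ring

/-- In the Stirling recursion the top index shifts by one, and `H_{l+1} = H_l + 1/(l+1)` adds
`x^(l+1)/(l+1)`, the antiderivative of `x^l`. This replaces harmonic numbers by an integral of
`(x)_k`, which can be estimated. -/
theorem harmonicPochhammer_succ (k : ℕ) (s : ℝ) :
    harmonicPochhammer (k + 1) (s * Complex.I)
      = (k + s * Complex.I) * harmonicPochhammer k (s * Complex.I)
        + Complex.I * ∫ τ in (0 : ℝ)..s, (ascPochhammer ℂ k).eval (τ * Complex.I) := by
  rw [I_mul_integral_ascPochhammer]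
  set x : ℂ := s * Complex.I
  have h1 : ∑ l ∈ Finset.range (k + 1),
      (harmonic (l + 1) : ℂ) * (Nat.stirlingFirst k (l + 1) : ℂ) * x ^ (l + 1)
      = harmonicPochhammer k x := by
    have h2 := Finset.sum_range_succ'
      (fun l => (harmonic l : ℂ) * (Nat.stirlingFirst k l : ℂ) * x ^ l) (k + 1)
    rw [Finset.sum_range_succ, Nat.stirlingFirst_eq_zero_of_lt (Nat.lt_succ_self k)] at h2
    simpa [harmonicPochhammer] using h2.symm
  rw [harmonicPochhammer, Finset.sum_range_succ', add_mul, ← h1]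
  nth_rewrite 2 [h1]
  rw [harmonicPochhammer, Finset.mul_sum, Finset.mul_sum, ← Finset.sum_add_distrib,
    ← Finset.sum_add_distrib]
  simp only [harmonic_zero, Rat.cast_zero, zero_mul, add_zero]
  refine Finset.sum_congr rfl fun l _ => ?_
  rw [Nat.stirlingFirst_succ_succ]
  have h3 : (harmonic (l + 1) : ℂ) = harmonic l + 1 / (l + 1) := by
    rw [harmonic_succ]; push_cast; ring
  push_cast
  linear_combination (Nat.stirlingFirst k l * x ^ (l + 1)) * h3

/-! ### Growth of both polynomial families on the imaginary axis. -/

theorem norm_natCast_add_mul_I_sq (m : ℕ) (s : ℝ) :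
    ‖(m : ℂ) + s * Complex.I‖ ^ 2 = m ^ 2 + s ^ 2 := by
  rw [← Complex.normSq_eq_norm_sq]
  simpa using Complex.normSq_add_mul_I (m : ℝ) s

theorem norm_ascPochhammer_mono (k : ℕ) {t s : ℝ} (ht : 0 ≤ t) (hts : t ≤ s) :
    ‖(ascPochhammer ℂ k).eval (t * Complex.I)‖ ≤ ‖(ascPochhammer ℂ k).eval (s * Complex.I)‖ := by
  induction k with
  | zero => simp
  | succ k ih =>
    rw [ascPochhammer_succ_eval, ascPochhammer_succ_eval, norm_mul, norm_mul]
    refine mul_le_mul ih ?_ (norm_nonneg _) (norm_nonneg _)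
    refine le_of_sq_le_sq ?_ (norm_nonneg _)
    rw [add_comm _ (k : ℂ), add_comm _ (k : ℂ), norm_natCast_add_mul_I_sq,
      norm_natCast_add_mul_I_sq]
    nlinarith

/-- The partial products increase to `sinh(πs)/(πs)`, by Euler's sine product at `is`, and `sinh y ≤
y exp y`. -/
theorem prod_one_add_sq_div_sq_le {s : ℝ} (hs : 0 < s) (j : ℕ) :
    ∏ i ∈ Finset.range j, (1 + s ^ 2 / ((i : ℝ) + 1) ^ 2) ≤ Real.exp (Real.pi * s) := by
  have hpi : 0 < Real.pi * s := by positivity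
  have h1 : Tendsto (fun m : ℕ => Real.pi * s *
      ∏ i ∈ Finset.range m, (1 + s ^ 2 / ((i : ℝ) + 1) ^ 2)) atTop
      (𝓝 (Real.sinh (Real.pi * s))) := by
    have h := (Complex.continuous_im.tendsto _).comp
      (Complex.tendsto_euler_sin_prod (s * Complex.I))
    have e1 : (Complex.sin (Real.pi * (s * Complex.I))).im = Real.sinh (Real.pi * s) := by
      rw [← mul_assoc, Complex.sin_mul_I, ← Complex.ofReal_mul, ← Complex.ofReal_sinh,
        Complex.im_ofReal_mul, Complex.I_im, mul_one]
    rw [e1] at h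
    refine h.congr fun m => ?_
    have e2 : ∀ i : ℕ, (1 : ℂ) - (s * Complex.I) ^ 2 / ((i : ℂ) + 1) ^ 2
        = ((1 + s ^ 2 / ((i : ℝ) + 1) ^ 2 : ℝ) : ℂ) := by
      intro i
      rw [mul_pow, Complex.I_sq]
      push_cast
      ring
    simp only [Function.comp_apply, e2]
    rw [← Complex.ofReal_prod, ← mul_assoc, mul_right_comm, ← Complex.ofReal_mul,
      ← Complex.ofReal_mul, Complex.im_ofReal_mul]
    simp
  have hmono : Monotone fun m : ℕ => Real.pi * s *
      ∏ i ∈ Finset.range m, (1 + s ^ 2 / ((i : ℝ) + 1) ^ 2) := by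
    refine monotone_nat_of_le_succ fun m => ?_
    rw [Finset.prod_range_succ]
    refine mul_le_mul_of_nonneg_left (le_mul_of_one_le_right (by positivity) ?_) hpi.le
    linarith [show 0 ≤ s ^ 2 / ((m : ℝ) + 1) ^ 2 by positivity]
  have h2 := hmono.ge_of_tendsto h1 j
  have h3 : Real.sinh (Real.pi * s) ≤ Real.pi * s * Real.exp (Real.pi * s) := by
    have h4 : 1 - 2 * (Real.pi * s) ≤ Real.exp (-(2 * (Real.pi * s))) := by
      linarith [Real.add_one_le_exp (-(2 * (Real.pi * s)))]
    have h5 : Real.exp (-(Real.pi * s))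
        = Real.exp (Real.pi * s) * Real.exp (-(2 * (Real.pi * s))) := by
      rw [← Real.exp_add]; ring_nf
    rw [Real.sinh_eq, h5]
    nlinarith [Real.exp_pos (Real.pi * s)]
  exact le_of_mul_le_mul_left (h2.trans h3) hpi

theorem norm_ascPochhammer_succ_le (j : ℕ) {s : ℝ} (hs : 0 < s) :
    ‖(ascPochhammer ℂ (j + 1)).eval (s * Complex.I)‖
      ≤ j.factorial * s * Real.exp (Real.pi * s / 2) := by
  have h : ‖(ascPochhammer ℂ (j + 1)).eval (s * Complex.I)‖ ^ 2
      = (j.factorial * s) ^ 2 * ∏ i ∈ Finset.range j, (1 + s ^ 2 / ((i : ℝ) + 1) ^ 2) := by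
    induction j with
    | zero => simp
    | succ j ih =>
      rw [ascPochhammer_succ_eval, norm_mul, mul_pow, ih, add_comm (_ * Complex.I),
        norm_natCast_add_mul_I_sq, Finset.prod_range_succ, Nat.factorial_succ]
      push_cast
      field_simp
  refine le_of_sq_le_sq ?_ (by positivity)
  have e : Real.exp (Real.pi * s / 2) ^ 2 = Real.exp (Real.pi * s) := by
    rw [← Real.exp_nat_mul]; push_cast; ring_nf
  rw [h, mul_pow _ (Real.exp _), e]
  exact mul_le_mul_of_nonneg_left (prod_one_add_sq_div_sq_le hs j) (by positivity)

/-- Passing from `j+1` to `j+2` in the recursion adds at most `s/(j+1)` to the ratio of the two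
norms. The true growth is logarithmic; `√(j+1)` is a cruder majorant that is still small enough for
summability. -/
theorem norm_harmonicPochhammer_succ_le_mul (j : ℕ) {s : ℝ} (hs : 0 ≤ s) :
    ‖harmonicPochhammer (j + 1) (s * Complex.I)‖
      ≤ ‖(ascPochhammer ℂ (j + 1)).eval (s * Complex.I)‖ * ((1 + s) * (4 * √((j : ℝ) + 1))) := by
  induction j with
  | zero =>
    rw [harmonicPochhammer_one]
    simp
    rw [abs_of_nonneg hs]
    nlinarith
  | succ j ih =>
    have hint : ‖∫ τ in (0 : ℝ)..s, (ascPochhammer ℂ (j + 1)).eval (τ * Complex.I)‖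
        ≤ ‖(ascPochhammer ℂ (j + 1)).eval (s * Complex.I)‖ * s := by
      refine (intervalIntegral.norm_integral_le_of_norm_le_const fun τ hτ => ?_).trans_eq
        (by rw [sub_zero, abs_of_nonneg hs])
      rw [uIoc_of_le hs] at hτ
      exact norm_ascPochhammer_mono _ hτ.1.le hτ.2
    rw [harmonicPochhammer_succ, ascPochhammer_succ_eval, norm_mul, add_comm (_ * Complex.I)]
    set N := ‖((j + 1 : ℕ) : ℂ) + s * Complex.I‖ with hN
    set R := ‖(ascPochhammer ℂ (j + 1)).eval (s * Complex.I)‖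
    have hNj : (j : ℝ) + 1 ≤ N := by
      have := Complex.abs_re_le_norm (((j + 1 : ℕ) : ℂ) + s * Complex.I)
      simp at this
      rw [abs_of_nonneg (by positivity)] at this
      simpa [hN] using this
    have hR : 0 ≤ R := norm_nonneg _
    -- The constant `4` is chosen so that `4(√(j+2) - √(j+1)) ≥ 1/(j+1)`, because `√(j+1) + √(j+2) ≤
    -- 2j + 3`.
    have hsq : 1 ≤ ((j : ℝ) + 1) * (4 * (√((j : ℝ) + 2) - √((j : ℝ) + 1))) := by
      have a1 := Real.sq_sqrt (show (0 : ℝ) ≤ (j : ℝ) + 1 by positivity)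
      have a2 := Real.sq_sqrt (show (0 : ℝ) ≤ (j : ℝ) + 2 by positivity)
      have p1 := Real.sqrt_pos.2 (show (0 : ℝ) < (j : ℝ) + 1 by positivity)
      have p2 := Real.sqrt_pos.2 (show (0 : ℝ) < (j : ℝ) + 2 by positivity)
      have j0 : (0 : ℝ) ≤ j := by positivity
      have b1 : √((j : ℝ) + 1) ≤ (j : ℝ) + 1 := Real.sqrt_le_iff.2 ⟨by positivity, by nlinarith⟩
      have b2 : √((j : ℝ) + 2) ≤ (j : ℝ) + 2 := Real.sqrt_le_iff.2 ⟨by positivity, by nlinarith⟩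
      have hd : √((j : ℝ) + 2) - √((j : ℝ) + 1) = 1 / (√((j : ℝ) + 2) + √((j : ℝ) + 1)) := by
        rw [eq_div_iff (by positivity)]
        nlinarith
      rw [hd, ← mul_assoc, mul_one_div, le_div_iff₀ (by positivity)]
      linarith
    refine (norm_add_le _ _).trans ?_
    rw [norm_mul, norm_mul, Complex.norm_I, one_mul]
    have hcast : ((j + 1 : ℕ) : ℝ) + 1 = (j : ℝ) + 2 := by push_cast; ring
    rw [hcast]
    have hfin : s ≤ N * ((1 + s) * (4 * (√((j : ℝ) + 2) - √((j : ℝ) + 1)))) := by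
      have hnn : 0 ≤ 4 * (√((j : ℝ) + 2) - √((j : ℝ) + 1)) := by
        have := Real.sqrt_le_sqrt (show (j : ℝ) + 1 ≤ j + 2 by linarith)
        linarith
      have h1 : 1 ≤ N * (4 * (√((j : ℝ) + 2) - √((j : ℝ) + 1))) :=
        hsq.trans (mul_le_mul_of_nonneg_right hNj hnn)
      nlinarith
    calc N * ‖harmonicPochhammer (j + 1) (s * Complex.I)‖ + _
        ≤ N * (R * ((1 + s) * (4 * √((j : ℝ) + 1)))) + R * s := by gcongr
      _ ≤ N * (R * ((1 + s) * (4 * √((j : ℝ) + 1))))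
          + R * (N * ((1 + s) * (4 * (√((j : ℝ) + 2) - √((j : ℝ) + 1))))) := by gcongr
      _ = _ := by ring

theorem norm_harmonicPochhammer_succ_le (j : ℕ) {s : ℝ} (hs : 0 < s) :
    ‖harmonicPochhammer (j + 1) (s * Complex.I)‖
      ≤ j.factorial * √((j : ℝ) + 1) * (s * (4 * (1 + s)) * Real.exp (Real.pi * s / 2)) := by
  refine (norm_harmonicPochhammer_succ_le_mul j hs.le).trans ?_
  refine (mul_le_mul_of_nonneg_right (norm_ascPochhammer_succ_le j hs) (by positivity)).trans_eq ?_
  ring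

/-- A deliberate weakening, so that both families satisfy one hypothesis in
`hasSum_integral_im_div_risingProd`. -/
theorem norm_ascPochhammer_succ_le' (j : ℕ) {s : ℝ} (hs : 0 < s) :
    ‖(ascPochhammer ℂ (j + 1)).eval (s * Complex.I)‖
      ≤ j.factorial * √((j : ℝ) + 1) * (s * (4 * (1 + s)) * Real.exp (Real.pi * s / 2)) := by
  refine (norm_ascPochhammer_succ_le j hs).trans ?_
  have h1 : 1 ≤ √((j : ℝ) + 1) := Real.one_le_sqrt.2 (by simp)
  calc j.factorial * s * Real.exp (Real.pi * s / 2)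
      = j.factorial * 1 * (s * 1 * Real.exp (Real.pi * s / 2)) := by ring
    _ ≤ _ := by
        gcongr
        linarith

/-! ### Decay of the weight, and the coefficients as integrals. -/

/-- `s w(s) = s exp(-πs)/sinh(πs)`, and `sinh(πs) ≥ πs`. -/
theorem mul_abelWeight_le {s : ℝ} (hs : 0 < s) :
    s * abelWeight s ≤ Real.exp (-(Real.pi * s)) := by
  have hx : 0 < Real.pi * s := by positivity
  have h1 : 2 * (Real.pi * s) * Real.exp (Real.pi * s) ≤ Real.exp (2 * Real.pi * s) - 1 := by
    have h2 := Real.self_le_sinh_iff.2 hx.le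
    rw [Real.sinh_eq] at h2
    have h3 : Real.exp (2 * Real.pi * s) = Real.exp (Real.pi * s) * Real.exp (Real.pi * s) := by
      rw [← Real.exp_add]; ring_nf
    have h4 : Real.exp (-(Real.pi * s)) * Real.exp (Real.pi * s) = 1 := by
      rw [← Real.exp_add]; simp
    nlinarith [Real.exp_pos (Real.pi * s)]
  have h5 : 2 * s * Real.exp (Real.pi * s) ≤ Real.exp (2 * Real.pi * s) - 1 := by
    refine le_trans ?_ h1
    gcongr
    nlinarith [Real.pi_gt_three]
  rw [abelWeight, mul_div_assoc', div_le_iff₀ (lt_of_lt_of_le (by positivity) h5), Real.exp_neg,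
    ← div_eq_inv_mul, le_div_iff₀ (Real.exp_pos _)]
  linarith

theorem abelWeight_nonneg {s : ℝ} (hs : 0 < s) : 0 ≤ abelWeight s := by
  refine div_nonneg zero_le_two (sub_nonneg.2 (Real.one_le_exp (by positivity)))

theorem measurable_abelWeight : Measurable abelWeight := by
  unfold abelWeight
  fun_prop

theorem mul_exp_mul_abelWeight_le {s : ℝ} (hs : 0 < s) :
    s * (4 * (1 + s)) * Real.exp (Real.pi * s / 2) * abelWeight s ≤ 8 * Real.exp (-s) := by
  have h1 : 1 + s ≤ 2 * Real.exp (s / 2) := by linarith [Real.add_one_le_exp (s / 2)]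
  calc s * (4 * (1 + s)) * Real.exp (Real.pi * s / 2) * abelWeight s
      = 4 * (1 + s) * Real.exp (Real.pi * s / 2) * (s * abelWeight s) := by ring
    _ ≤ 4 * (2 * Real.exp (s / 2)) * Real.exp (Real.pi * s / 2) * Real.exp (-(Real.pi * s)) := by
        gcongr
        · exact mul_nonneg hs.le (abelWeight_nonneg hs)
        · exact mul_abelWeight_le hs
    _ = 8 * Real.exp (s / 2 + Real.pi * s / 2 + -(Real.pi * s)) := by
        rw [Real.exp_add, Real.exp_add]; ring
    _ ≤ 8 * Real.exp (-s) := by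
        gcongr
        -- The exponent is `(1 - π)s/2`, which is at most `-s` exactly because `π ≥ 3`.
        nlinarith [Real.pi_gt_three]

theorem integrableOn_exp_neg : IntegrableOn (fun s : ℝ => Real.exp (-s)) (Ioi 0) := by
  simpa using exp_neg_integrableOn_Ioi 0 one_pos

theorem integrableOn_im_pow_mul_abelWeight (l : ℕ) :
    IntegrableOn (fun s : ℝ => ((s * Complex.I) ^ l).im * abelWeight s) (Ioi 0) := by
  cases l with
  | zero => simp
  | succ l =>
    refine Integrable.mono' (integrableOn_exp_neg.const_mul (l.factorial : ℝ)) ?_ ?_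
    · exact (Measurable.mul (by fun_prop) measurable_abelWeight).aestronglyMeasurable
    · refine (ae_restrict_iff' measurableSet_Ioi).2 (ae_of_all _ fun s hs => ?_)
      have hs' : (0 : ℝ) < s := hs
      have h1 : |((s * Complex.I) ^ (l + 1)).im| ≤ s ^ (l + 1) := by
        refine (Complex.abs_im_le_norm _).trans_eq ?_
        simp [abs_of_pos hs']
      have h2 := Real.pow_div_factorial_le_exp s hs'.le l
      rw [div_le_iff₀ (by positivity)] at h2
      rw [norm_mul, Real.norm_eq_abs, Real.norm_eq_abs, abs_of_nonneg (abelWeight_nonneg hs')]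
      calc |((s * Complex.I) ^ (l + 1)).im| * abelWeight s
          ≤ s ^ (l + 1) * abelWeight s :=
            mul_le_mul_of_nonneg_right h1 (abelWeight_nonneg hs')
        _ = s ^ l * (s * abelWeight s) := by ring
        _ ≤ (Real.exp s * l.factorial) * Real.exp (-(Real.pi * s)) := by
            gcongr
            · exact mul_nonneg hs'.le (abelWeight_nonneg hs')
            · exact mul_abelWeight_le hs'
        _ = l.factorial * Real.exp (s + -(Real.pi * s)) := by rw [Real.exp_add]; ring
        _ ≤ l.factorial * Real.exp (-s) := by
            gcongr
            nlinarith [Real.pi_gt_three]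

/-- The Abel–Plana weight evaluates polynomials with real coefficients and no constant term. -/
theorem integral_im_sum_mul_abelWeight (c : ℕ → ℝ) (k : ℕ) :
    ∫ s in Ioi (0 : ℝ), (∑ l ∈ Finset.range (k + 1), (c l : ℂ) * (s * Complex.I) ^ l).im
        * abelWeight s
      = ∑ l ∈ Finset.Icc 1 k, c l * ((bernoulli (l + 1) : ℝ) / (l + 1)) := by
  have h1 : ∀ s : ℝ, (∑ l ∈ Finset.range (k + 1), (c l : ℂ) * (s * Complex.I) ^ l).im
        * abelWeight s
      = ∑ l ∈ Finset.Icc 1 k, c l * (((s * Complex.I) ^ l).im * abelWeight s) := by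
    intro s
    rw [Finset.sum_range_eq_add_Ico _ (Nat.succ_pos k), Complex.add_im, Complex.im_sum, add_mul,
      Finset.sum_mul]
    have h0 : ((c 0 : ℂ) * (s * Complex.I) ^ 0).im = 0 := by simp
    rw [h0, zero_mul, zero_add]
    refine Finset.sum_congr (by ext; simp) fun l _ => ?_
    rw [Complex.im_ofReal_mul]
    ring
  simp only [h1]
  rw [integral_finsetSum _ fun l _ => (integrableOn_im_pow_mul_abelWeight l).const_mul _]
  refine Finset.sum_congr rfl fun l hl => ?_
  rw [integral_const_mul, integral_im_pow_mul_abelWeight l (by simp at hl; omega)]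

/-- For even `l` both sides vanish, as `l + 1 ≥ 3` is odd. This reconciles the signs in `coeffA` and
`coeffB` with the unsigned Stirling numbers. -/
theorem neg_one_pow_mul_bernoulli_succ {l : ℕ} (hl : 1 ≤ l) :
    (-1 : ℝ) ^ l * (bernoulli (l + 1) : ℝ) = -(bernoulli (l + 1) : ℝ) := by
  rcases Nat.even_or_odd l with h | h
  · rw [bernoulli_eq_zero_of_odd h.add_one (by omega)]
    simp
  · rw [h.neg_one_pow]; ring

theorem neg_one_pow_mul_stirlingS (k l : ℕ) :
    (-1 : ℝ) ^ k * (stirlingS k l : ℝ) = (-1) ^ l * Nat.stirlingFirst k l := by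
  simp only [stirlingS, Int.cast_mul, Int.cast_pow, Int.cast_neg, Int.cast_one, Int.cast_natCast]
  rw [pow_add]
  linear_combination ((-1 : ℝ) ^ l * Nat.stirlingFirst k l) * pow_mul_pow_eq_one k
    (show (-1 : ℝ) * -1 = 1 by norm_num)

theorem coeffA_eq_integral (k : ℕ) :
    coeffA k = ∫ s in Ioi (0 : ℝ), (harmonicPochhammer k (s * Complex.I)).im * abelWeight s := by
  have h := integral_im_sum_mul_abelWeight
    (fun l => (harmonic l : ℝ) * (Nat.stirlingFirst k l : ℝ)) k
  simp only [Complex.ofReal_mul, Complex.ofReal_ratCast, Complex.ofReal_natCast] at h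
  simp only [harmonicPochhammer]
  rw [h, coeffA, Finset.mul_sum]
  refine Finset.sum_congr rfl fun l hl => ?_
  have hl1 : 1 ≤ l := (Finset.mem_Icc.1 hl).1
  have e1 := neg_one_pow_mul_stirlingS k l
  have e2 : (stirlingS (l + 1) 2 : ℝ) = (-1) ^ (l + 1) * (l.factorial * (harmonic l : ℝ)) := by
    have : (Nat.stirlingFirst (l + 1) 2 : ℝ) = l.factorial * (harmonic l : ℝ) := by
      exact_mod_cast congrArg (fun q : ℚ => (q : ℝ)) (stirlingFirst_succ_two l)
    rw [stirlingS]
    push_cast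
    rw [this]
    ring
  have e3 := neg_one_pow_mul_bernoulli_succ hl1
  have e4 : (-1 : ℝ) ^ l * (-1) ^ l = 1 := by rw [← mul_pow]; simp
  rw [e2, Nat.factorial_succ, pow_succ]
  push_cast
  have hf : (l.factorial : ℝ) ≠ 0 := by positivity
  have hl' : (l : ℝ) + 1 ≠ 0 := by positivity
  field_simp
  linear_combination (-(-1 : ℝ) ^ l * (-1) ^ l * (bernoulli (l + 1) : ℝ) * (harmonic l : ℝ)) * e1
    - ((-1 : ℝ) ^ l * (-1) ^ l * (harmonic l : ℝ) * (Nat.stirlingFirst k l : ℝ)) * e3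
    + ((bernoulli (l + 1) : ℝ) * (harmonic l : ℝ) * (Nat.stirlingFirst k l : ℝ)) * e4

theorem coeffB_eq_integral (k : ℕ) :
    coeffB k = -∫ s in Ioi (0 : ℝ), ((ascPochhammer ℂ k).eval (s * Complex.I)).im
      * abelWeight s := by
  have h := integral_im_sum_mul_abelWeight (fun l => (Nat.stirlingFirst k l : ℝ)) k
  simp only [Complex.ofReal_natCast] at h
  simp only [pochhammer_eq_sum_stirlingFirst]
  rw [h, coeffB, Finset.mul_sum, ← Finset.sum_neg_distrib]
  refine Finset.sum_congr rfl fun l hl => ?_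
  have hl1 : 1 ≤ l := (Finset.mem_Icc.1 hl).1
  have e1 := neg_one_pow_mul_stirlingS k l
  have e3 := neg_one_pow_mul_bernoulli_succ hl1
  linear_combination ((bernoulli (l + 1) : ℝ) / (l + 1)) * e1
    + ((Nat.stirlingFirst k l : ℝ) / (l + 1)) * e3

/-! ### Inverse factorial series of `1/(n-x)` and `(log n - log(n-x))/(n-x)`. -/

/-- The product `n (n+1) ⋯ (n+K-1)`. -/
noncomputable def pochProd (n K : ℕ) : ℝ := ∏ i ∈ Finset.range K, ((n : ℝ) + i)

theorem pochProd_succ (n K : ℕ) : pochProd n (K + 1) = pochProd n K * (n + K) :=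
  Finset.prod_range_succ _ _

theorem risingProd_eq (n k : ℕ) : risingProd n k = pochProd n (k + 1) := rfl

variable {n : ℕ}

theorem factorial_le_pochProd (hn : 1 ≤ n) (K : ℕ) : (K.factorial : ℝ) ≤ pochProd n K := by
  induction K with
  | zero => simp [pochProd]
  | succ K ih =>
    have hn' : (1 : ℝ) ≤ n := by exact_mod_cast hn
    rw [pochProd_succ, Nat.factorial_succ, mul_comm]
    push_cast
    refine mul_le_mul ih (by linarith) (by positivity) ((by positivity : (0 : ℝ) ≤ _).trans ih)

theorem pochProd_pos (hn : 1 ≤ n) (K : ℕ) : 0 < pochProd n K :=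
  lt_of_lt_of_le (by positivity) (factorial_le_pochProd hn K)

theorem risingProd_nonneg (hn : 1 ≤ n) (k : ℕ) : 0 ≤ risingProd n k := (pochProd_pos hn _).le

theorem factorial_mul_sqrt_div_risingProd_le (hn : 1 ≤ n) (j : ℕ) :
    j.factorial * √((j : ℝ) + 1) / risingProd n (j + 1)
      ≤ 1 / ((j + 1 : ℕ) : ℝ) ^ (3 / 2 : ℝ) := by
  -- `risingProd n (j + 1)` has `j + 2` factors.
  have h1 : ((j + 2).factorial : ℝ) ≤ risingProd n (j + 1) := factorial_le_pochProd hn (j + 2)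
  have hj : (0 : ℝ) < (j : ℝ) + 1 := by positivity
  have h2 : ((j + 1 : ℕ) : ℝ) ^ (3 / 2 : ℝ) = ((j : ℝ) + 1) * √((j : ℝ) + 1) := by
    rw [Real.sqrt_eq_rpow, show (3 / 2 : ℝ) = 1 + 1 / 2 by norm_num, Real.rpow_add (by positivity),
      Real.rpow_one]
    push_cast
    rfl
  have hs := Real.sqrt_pos.2 hj
  refine (div_le_div_of_nonneg_left (by positivity) (by positivity) h1).trans ?_
  rw [h2, div_le_div_iff₀ (by positivity) (by positivity), Nat.factorial_succ, Nat.factorial_succ]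
  push_cast
  have hsq := Real.mul_self_sqrt hj.le
  calc j.factorial * √((j : ℝ) + 1) * (((j : ℝ) + 1) * √((j : ℝ) + 1))
      = j.factorial * ((j : ℝ) + 1) * (√((j : ℝ) + 1) * √((j : ℝ) + 1)) := by ring
    _ = j.factorial * ((j : ℝ) + 1) * ((j : ℝ) + 1) := by rw [hsq]
    _ ≤ j.factorial * ((j : ℝ) + 1) * ((j : ℝ) + 1 + 1) := by gcongr; linarith
    _ = _ := by ring

theorem summable_factorial_mul_sqrt_div_risingProd (hn : 1 ≤ n) :
    Summable fun j : ℕ => j.factorial * √((j : ℝ) + 1) / risingProd n (j + 1) := by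
  refine Summable.of_nonneg_of_le
    (fun j => div_nonneg (by positivity) (pochProd_pos hn _).le)
    (factorial_mul_sqrt_div_risingProd_le hn) ?_
  exact (summable_nat_add_iff 1).2 (Real.summable_one_div_nat_rpow.2 (by norm_num))

theorem summable_div_risingProd (hn : 1 ≤ n) {c : ℕ → ℂ} {B : ℝ}
    (hc : ∀ j : ℕ, ‖c (j + 1)‖ ≤ j.factorial * √((j : ℝ) + 1) * B) :
    Summable fun k => c k / (risingProd n k : ℂ) := by
  refine (summable_nat_add_iff 1).1 (Summable.of_norm_bounded
    ((summable_factorial_mul_sqrt_div_risingProd hn).mul_right B) fun j => ?_)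
  rw [norm_div, Complex.norm_real, Real.norm_of_nonneg (risingProd_nonneg hn _), div_mul_eq_mul_div]
  exact div_le_div_of_nonneg_right (hc j) (risingProd_nonneg hn _)

theorem tendsto_div_pochProd (hn : 1 ≤ n) {c : ℕ → ℂ} {B : ℝ}
    (hc : ∀ j : ℕ, ‖c (j + 1)‖ ≤ j.factorial * √((j : ℝ) + 1) * B) :
    Tendsto (fun k => c k / (pochProd n k : ℂ)) atTop (𝓝 0) := by
  refine (tendsto_add_atTop_iff_nat 1).1 ?_
  have h0 : Tendsto (fun j : ℕ => B / √((j : ℝ) + 1)) atTop (𝓝 0) :=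
    Tendsto.div_atTop tendsto_const_nhds (Real.tendsto_sqrt_atTop.comp
      (tendsto_atTop_add_const_right _ _ tendsto_natCast_atTop_atTop))
  refine squeeze_zero_norm (fun j => ?_) h0
  have hB : 0 ≤ j.factorial * √((j : ℝ) + 1) * B := (norm_nonneg _).trans (hc j)
  have hj : (0 : ℝ) < (j : ℝ) + 1 := by positivity
  have hs := Real.sqrt_pos.2 hj
  rw [norm_div, Complex.norm_real, Real.norm_of_nonneg (pochProd_pos hn _).le]
  refine (div_le_div₀ hB (hc j) (by positivity) (factorial_le_pochProd hn (j + 1))).trans_eq ?_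
  rw [Nat.factorial_succ]
  push_cast
  have hsq := Real.mul_self_sqrt hj.le
  rw [div_eq_div_iff (by positivity) hs.ne']
  linear_combination (B * j.factorial) * hsq

theorem natCast_sub_mul_I_ne_zero (hn : 1 ≤ n) (s : ℝ) : (n : ℂ) - s * Complex.I ≠ 0 := by
  intro h
  have := congrArg Complex.re h
  simp at this
  omega

/-- The sum telescopes because `(n + K) - (x + K) = n - x`. -/
theorem sum_ascPochhammer_div_risingProd (hn : 1 ≤ n) {x : ℂ} (hx : (n : ℂ) - x ≠ 0) (K : ℕ) :
    ∑ k ∈ Finset.range K, (ascPochhammer ℂ k).eval x / (risingProd n k : ℂ)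
      = (1 - (ascPochhammer ℂ K).eval x / (pochProd n K : ℂ)) / (n - x) := by
  induction K with
  | zero => simp [pochProd]
  | succ K ih =>
    have h1 : (pochProd n K : ℂ) ≠ 0 := by exact_mod_cast (pochProd_pos hn K).ne'
    have h2 : (n : ℂ) + K ≠ 0 := by exact_mod_cast (show n + K ≠ 0 by omega)
    rw [Finset.sum_range_succ, ih, risingProd_eq, pochProd_succ, ascPochhammer_succ_eval]
    push_cast
    field_simp
    ring

theorem hasSum_ascPochhammer_div_risingProd (hn : 1 ≤ n) {s : ℝ} (hs : 0 < s) :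
    HasSum (fun k => (ascPochhammer ℂ k).eval (s * Complex.I) / (risingProd n k : ℂ))
      (1 / (n - s * Complex.I)) := by
  have hb := fun j => norm_ascPochhammer_succ_le' j hs
  have hsum := summable_div_risingProd hn
    (c := fun k => (ascPochhammer ℂ k).eval (s * Complex.I)) hb
  have ht := ((tendsto_div_pochProd hn
    (c := fun k => (ascPochhammer ℂ k).eval (s * Complex.I)) hb).const_sub 1).div_const ((n : ℂ) - s * Complex.I)
  rw [sub_zero] at ht
  convert hsum.hasSum using 1
  refine tendsto_nhds_unique (ht.congr fun K => ?_) hsum.hasSum.tendsto_sum_nat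
  exact (sum_ascPochhammer_div_risingProd hn (natCast_sub_mul_I_ne_zero hn s) K).symm

theorem I_mul_integral_one_div (hn : 1 ≤ n) (s : ℝ) :
    Complex.I * ∫ τ in (0 : ℝ)..s, 1 / ((n : ℂ) - τ * Complex.I)
      = Complex.log n - Complex.log (n - s * Complex.I) := by
  have hn' : (0 : ℝ) < n := by exact_mod_cast hn
  have hder : ∀ τ : ℝ, HasDerivAt (fun τ : ℝ => -Complex.log ((n : ℂ) - τ * Complex.I))
      (Complex.I * (1 / ((n : ℂ) - τ * Complex.I))) τ := by
    intro τ
    have h1 : HasDerivAt (fun τ : ℝ => (n : ℂ) - τ * Complex.I) (-(1 * Complex.I)) τ :=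
      ((HasDerivAt.ofReal_comp (hasDerivAt_id τ)).mul_const _).const_sub _
    have h2 := (h1.clog_real (Or.inl (by simpa using hn'))).neg
    convert! h2 using 1
    ring
  rw [← intervalIntegral.integral_const_mul,
    intervalIntegral.integral_eq_sub_of_hasDerivAt (fun τ _ => hder τ)]
  · simp
    ring
  · refine Continuous.intervalIntegrable ?_ _ _
    exact continuous_const.mul (continuous_const.div (by fun_prop) (natCast_sub_mul_I_ne_zero hn))

/-- Harmonic counterpart of the telescoping identity. The integral remainder obeys its own
recursion, from `(τi + K)/(n + K) = 1 - (n - τi)/(n + K)`, and the term it sheds cancels the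
integral in `harmonicPochhammer_succ`. At `K = 0` it equals the whole difference of logarithms. -/
theorem sum_harmonicPochhammer_div_risingProd (hn : 1 ≤ n) (s : ℝ) (K : ℕ) :
    (n - s * Complex.I) * ∑ k ∈ Finset.range K,
        harmonicPochhammer k (s * Complex.I) / (risingProd n k : ℂ)
      = Complex.log n - Complex.log (n - s * Complex.I)
        - Complex.I * (∫ τ in (0 : ℝ)..s, (ascPochhammer ℂ K).eval (τ * Complex.I)
          / (pochProd n K : ℂ) / (n - τ * Complex.I))
        - harmonicPochhammer K (s * Complex.I) / (pochProd n K : ℂ) := by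
  have hcont : ∀ K, Continuous fun τ : ℝ => (ascPochhammer ℂ K).eval (τ * Complex.I) := fun K =>
    (ascPochhammer ℂ K).continuous.comp (by fun_prop)
  have hq : ∀ K, Continuous fun τ : ℝ => (ascPochhammer ℂ K).eval (τ * Complex.I)
      / (pochProd n K : ℂ) / (n - τ * Complex.I) := fun K =>
    ((hcont K).div_const _).div (by fun_prop) (natCast_sub_mul_I_ne_zero hn)
  induction K with
  | zero =>
    simp only [Finset.range_zero, Finset.sum_empty, mul_zero, harmonicPochhammer_zero,
      sub_zero, ascPochhammer_zero, Polynomial.eval_one, pochProd, Finset.prod_empty,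
      Complex.ofReal_one, div_one]
    rw [I_mul_integral_one_div hn, sub_self]
  | succ K ih =>
    have h1 : (pochProd n K : ℂ) ≠ 0 := by exact_mod_cast (pochProd_pos hn K).ne'
    have h2 : (n : ℂ) + K ≠ 0 := by exact_mod_cast (show n + K ≠ 0 by omega)
    have h3 : ∫ τ in (0 : ℝ)..s, (ascPochhammer ℂ (K + 1)).eval (τ * Complex.I)
          / (pochProd n (K + 1) : ℂ) / (n - τ * Complex.I)
        = (∫ τ in (0 : ℝ)..s, (ascPochhammer ℂ K).eval (τ * Complex.I)
          / (pochProd n K : ℂ) / (n - τ * Complex.I))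
          - (∫ τ in (0 : ℝ)..s, (ascPochhammer ℂ K).eval (τ * Complex.I))
            / (pochProd n (K + 1) : ℂ) := by
      rw [← intervalIntegral.integral_div, ← intervalIntegral.integral_sub
        ((hq K).intervalIntegrable _ _) (((hcont K).div_const _).intervalIntegrable _ _)]
      refine intervalIntegral.integral_congr fun τ _ => ?_
      have h4 := natCast_sub_mul_I_ne_zero hn τ
      simp only [pochProd_succ, ascPochhammer_succ_eval]
      push_cast
      field_simp
      ring
    rw [Finset.sum_range_succ, mul_add, ih, h3, harmonicPochhammer_succ, risingProd_eq,
      pochProd_succ]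
    push_cast
    field_simp
    ring

theorem tendsto_integral_ascPochhammer_div (hn : 1 ≤ n) {s : ℝ} (hs : 0 < s) :
    Tendsto (fun K => ∫ τ in (0 : ℝ)..s, (ascPochhammer ℂ K).eval (τ * Complex.I)
      / (pochProd n K : ℂ) / (n - τ * Complex.I)) atTop (𝓝 0) := by
  have h0 := (tendsto_div_pochProd hn
    (c := fun k => (ascPochhammer ℂ k).eval (s * Complex.I))
    fun j => norm_ascPochhammer_succ_le' j hs).norm.mul_const s
  rw [norm_zero, zero_mul] at h0
  refine squeeze_zero_norm (fun K => ?_) h0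
  refine (intervalIntegral.norm_integral_le_of_norm_le_const fun τ hτ => ?_).trans_eq
    (by rw [sub_zero, abs_of_pos hs])
  rw [uIoc_of_le hs.le] at hτ
  have h1 : 1 ≤ ‖(n : ℂ) - τ * Complex.I‖ := by
    have h2 := Complex.abs_re_le_norm ((n : ℂ) - τ * Complex.I)
    simp at h2
    exact le_trans (by exact_mod_cast hn) h2
  rw [norm_div, norm_div, norm_div]
  refine (div_le_self (by positivity) h1).trans ?_
  gcongr
  exact norm_ascPochhammer_mono K hτ.1.le hτ.2

theorem hasSum_harmonicPochhammer_div_risingProd (hn : 1 ≤ n) {s : ℝ} (hs : 0 < s) :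
    HasSum (fun k => harmonicPochhammer k (s * Complex.I) / (risingProd n k : ℂ))
      ((Complex.log n - Complex.log (n - s * Complex.I)) / (n - s * Complex.I)) := by
  have hb := fun j => norm_harmonicPochhammer_succ_le j hs
  have hsum := summable_div_risingProd hn
    (c := fun k => harmonicPochhammer k (s * Complex.I)) hb
  have hne := natCast_sub_mul_I_ne_zero hn s
  have ht := (((tendsto_integral_ascPochhammer_div hn hs).const_mul Complex.I).const_sub
    (Complex.log n - Complex.log (n - s * Complex.I))).sub (tendsto_div_pochProd hn
    (c := fun k => harmonicPochhammer k (s * Complex.I)) hb)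
  rw [mul_zero, sub_zero, sub_zero] at ht
  convert hsum.hasSum using 1
  rw [div_eq_iff hne, mul_comm (tsum _)]
  refine tendsto_nhds_unique (ht.congr fun K => ?_) (hsum.hasSum.tendsto_sum_nat.const_mul _)
  exact (sum_harmonicPochhammer_div_risingProd hn s K).symm

/-! ### Termwise integration against the weight. -/

/-- The integrals of the absolute values are summable, which justifies the interchange. The growth
bound covers only `k ≥ 1`, so `hc0` disposes of the term `k = 0`. -/
theorem hasSum_integral_im_div_risingProd (hn : 1 ≤ n) {c : ℕ → ℝ → ℂ} {g : ℝ → ℂ}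
    (hcm : ∀ k, Measurable (c k)) (hc0 : ∀ s, (c 0 s).im = 0)
    (hc : ∀ (j : ℕ) {s : ℝ}, 0 < s → ‖c (j + 1) s‖
      ≤ j.factorial * √((j : ℝ) + 1) * (s * (4 * (1 + s)) * Real.exp (Real.pi * s / 2)))
    (hg : ∀ {s : ℝ}, 0 < s → HasSum (fun k => c k s / (risingProd n k : ℂ)) (g s)) :
    HasSum (fun k => (∫ s in Ioi (0 : ℝ), (c k s).im * abelWeight s) / risingProd n k)
      (∫ s in Ioi (0 : ℝ), (g s).im * abelWeight s) := by
  set F : ℕ → ℝ → ℝ := fun k s => (c k s).im * abelWeight s / risingProd n k with hF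
  have hbound : ∀ (j : ℕ) {s : ℝ}, 0 < s → ‖F (j + 1) s‖
      ≤ j.factorial * √((j : ℝ) + 1) / risingProd n (j + 1) * 8 * Real.exp (-s) := by
    intro j s hs
    have hw := abelWeight_nonneg hs
    rw [norm_div, norm_mul, Real.norm_of_nonneg (risingProd_nonneg hn _), Real.norm_of_nonneg hw,
      div_mul_eq_mul_div, div_mul_eq_mul_div]
    refine div_le_div_of_nonneg_right ?_ (risingProd_nonneg hn _)
    calc ‖(c (j + 1) s).im‖ * abelWeight s
        ≤ j.factorial * √((j : ℝ) + 1) * (s * (4 * (1 + s)) * Real.exp (Real.pi * s / 2))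
          * abelWeight s :=
          mul_le_mul_of_nonneg_right ((Complex.abs_im_le_norm _).trans (hc j hs)) hw
      _ = j.factorial * √((j : ℝ) + 1)
          * (s * (4 * (1 + s)) * Real.exp (Real.pi * s / 2) * abelWeight s) := by ring
      _ ≤ j.factorial * √((j : ℝ) + 1) * (8 * Real.exp (-s)) :=
          mul_le_mul_of_nonneg_left (mul_exp_mul_abelWeight_le hs) (by positivity)
      _ = _ := by ring
  have hae : ∀ j : ℕ, ∀ᵐ s ∂volume.restrict (Ioi (0 : ℝ)), ‖F (j + 1) s‖
      ≤ j.factorial * √((j : ℝ) + 1) / risingProd n (j + 1) * 8 * Real.exp (-s) := fun j =>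
    (ae_restrict_iff' measurableSet_Ioi).2 (ae_of_all _ fun s hs => hbound j hs)
  have hint : ∀ k, IntegrableOn (F k) (Ioi 0) := by
    intro k
    cases k with
    | zero => simp [hF, hc0]
    | succ j =>
      refine Integrable.mono' (integrableOn_exp_neg.const_mul _) ?_ (hae j)
      exact (((Complex.measurable_im.comp (hcm _)).mul measurable_abelWeight).div_const
        _).aestronglyMeasurable
  have hsum : Summable fun k => ∫ s in Ioi (0 : ℝ), ‖F k s‖ := by
    refine (summable_nat_add_iff 1).1 (Summable.of_nonneg_of_le
      (fun j => integral_nonneg fun s => norm_nonneg _) (fun j => ?_)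
      (((summable_factorial_mul_sqrt_div_risingProd hn).mul_right 8).mul_right
        (∫ s in Ioi (0 : ℝ), Real.exp (-s))))
    rw [← integral_const_mul]
    exact integral_mono_ae (hint _).norm (integrableOn_exp_neg.const_mul _) (hae j)
  have key := hasSum_integral_of_summable_integral_norm hint hsum
  have e1 : ∫ s in Ioi (0 : ℝ), ∑' k, F k s = ∫ s in Ioi (0 : ℝ), (g s).im * abelWeight s := by
    refine setIntegral_congr_fun measurableSet_Ioi fun s hs => ?_
    have h1 := (Complex.hasSum_im (hg hs)).mul_right (abelWeight s)
    refine (h1.congr_fun fun k => ?_).tsum_eq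
    rw [Complex.div_ofReal_im]
    simp only [hF]
    ring
  rw [e1] at key
  simpa only [hF, integral_div] using key

theorem measurable_ascPochhammer_mul_I (k : ℕ) :
    Measurable fun s : ℝ => (ascPochhammer ℂ k).eval (s * Complex.I) :=
  ((ascPochhammer ℂ k).continuous.comp (by fun_prop)).measurable

theorem hasSum_coeffA (hn : 1 ≤ n) : HasSum (fun k => coeffA k / risingProd n k)
    (∫ s in Ioi (0 : ℝ), ((Complex.log n - Complex.log (n - s * Complex.I))
      / (n - s * Complex.I)).im * abelWeight s) := by
  simp only [coeffA_eq_integral]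
  refine hasSum_integral_im_div_risingProd hn (fun k => ?_) (fun s => ?_)
    norm_harmonicPochhammer_succ_le (hasSum_harmonicPochhammer_div_risingProd hn)
  · unfold harmonicPochhammer
    fun_prop
  · simp [harmonicPochhammer_zero]

theorem hasSum_coeffB (hn : 1 ≤ n) : HasSum (fun k => coeffB k / risingProd n k)
    (-∫ s in Ioi (0 : ℝ), (1 / ((n : ℂ) - s * Complex.I)).im * abelWeight s) := by
  simp only [coeffB_eq_integral, neg_div]
  refine (hasSum_integral_im_div_risingProd hn measurable_ascPochhammer_mul_I (fun s => ?_)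
    norm_ascPochhammer_succ_le' (hasSum_ascPochhammer_div_risingProd hn)).neg
  simp

/-! ### The correction term for `log z / z` and the Stieltjes constant. -/

theorem natCast_le_norm_sub_mul_I (n : ℕ) (s : ℝ) : (n : ℝ) ≤ ‖(n : ℂ) - s * Complex.I‖ := by
  have h := Complex.abs_re_le_norm ((n : ℂ) - s * Complex.I)
  simpa using h

theorem abs_im_log_sub_log_div_le (hn : 1 ≤ n) {s : ℝ} (hs : 0 < s) :
    |((Complex.log n - Complex.log (n - s * Complex.I)) / (n - s * Complex.I)).im|
      ≤ s / n ^ 2 := by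
  have hn' : (0 : ℝ) < n := by exact_mod_cast hn
  refine (Complex.abs_im_le_norm _).trans ?_
  have h1 : ‖Complex.log n - Complex.log (n - s * Complex.I)‖ ≤ s / n := by
    rw [← I_mul_integral_one_div hn, norm_mul, Complex.norm_I, one_mul]
    refine (intervalIntegral.norm_integral_le_of_norm_le_const (C := 1 / n) fun τ _ => ?_).trans_eq
      (by rw [sub_zero, abs_of_pos hs]; ring)
    rw [norm_div, norm_one]
    exact one_div_le_one_div_of_le hn' (natCast_le_norm_sub_mul_I n τ)
  rw [norm_div]
  refine (div_le_div₀ (by positivity) h1 hn' (natCast_le_norm_sub_mul_I n s)).trans_eq ?_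
  field_simp

theorem abs_im_one_div_le (hn : 1 ≤ n) {s : ℝ} (hs : 0 < s) :
    |(1 / ((n : ℂ) - s * Complex.I)).im| ≤ s / n ^ 2 := by
  have hn' : (0 : ℝ) < n := by exact_mod_cast hn
  have h1 : (1 / ((n : ℂ) - s * Complex.I)).im = s / (n ^ 2 + s ^ 2) := by
    simp [Complex.normSq_apply]
    ring
  rw [h1, abs_of_nonneg (by positivity)]
  gcongr
  nlinarith

theorem norm_mul_abelWeight_le {u : ℝ → ℝ} {B : ℝ} {s : ℝ} (hs : 0 < s) (hB : 0 ≤ B)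
    (hu : |u s| ≤ s * B) : ‖u s * abelWeight s‖ ≤ B * Real.exp (-s) := by
  have hw := abelWeight_nonneg hs
  rw [norm_mul, Real.norm_eq_abs, Real.norm_of_nonneg hw]
  calc |u s| * abelWeight s ≤ s * B * abelWeight s := mul_le_mul_of_nonneg_right hu hw
    _ = B * (s * abelWeight s) := by ring
    _ ≤ B * Real.exp (-(Real.pi * s)) := mul_le_mul_of_nonneg_left (mul_abelWeight_le hs) hB
    _ ≤ B * Real.exp (-s) := by
        gcongr
        nlinarith [Real.pi_gt_three]

theorem integrableOn_mul_abelWeight {u : ℝ → ℝ} {B : ℝ} (hB : 0 ≤ B) (hm : Measurable u)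
    (hu : ∀ s, 0 < s → |u s| ≤ s * B) :
    IntegrableOn (fun s => u s * abelWeight s) (Ioi 0) :=
  Integrable.mono' (integrableOn_exp_neg.const_mul B)
    (hm.mul measurable_abelWeight).aestronglyMeasurable
    ((ae_restrict_iff' measurableSet_Ioi).2 (ae_of_all _ fun s hs =>
      norm_mul_abelWeight_le (u := u) hs hB (hu s hs)))

theorem abs_integral_mul_abelWeight_le {u : ℝ → ℝ} {B : ℝ} (hB : 0 ≤ B)
    (hu : ∀ s, 0 < s → |u s| ≤ s * B) :
    |∫ s in Ioi (0 : ℝ), u s * abelWeight s| ≤ B := by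
  have h := norm_integral_le_of_norm_le (integrableOn_exp_neg.const_mul B)
    ((ae_restrict_iff' measurableSet_Ioi).2 (ae_of_all _ fun s hs =>
      norm_mul_abelWeight_le (u := u) hs hB (hu s hs)))
  rwa [integral_const_mul, integral_exp_neg_Ioi_zero, mul_one, Real.norm_eq_abs] at h

/-- `n - is` is the conjugate of `n + is`, so passing to it flips the sign of the imaginary part;
adding and subtracting `log n` then isolates the two functions expanded above. -/
theorem im_log_div_eq (hn : 1 ≤ n) (s : ℝ) :
    (Complex.log (n + s * Complex.I) / (n + s * Complex.I)).im
      = ((Complex.log n - Complex.log (n - s * Complex.I)) / (n - s * Complex.I)).im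
        - Real.log n * (1 / ((n : ℂ) - s * Complex.I)).im := by
  have hn' : (0 : ℝ) < n := by exact_mod_cast hn
  have harg : ((n : ℂ) + s * Complex.I).arg ≠ Real.pi := by
    intro h
    have := (Complex.arg_eq_pi_iff.1 h).1
    simp at this
    linarith
  have h1 : (n : ℂ) - s * Complex.I = (starRingEnd ℂ) (n + s * Complex.I) := by
    simp [sub_eq_add_neg]
  have h2 : Complex.log (n : ℂ) = ((Real.log n : ℝ) : ℂ) := (Complex.natCast_log).symm
  rw [h1, Complex.log_conj _ harg, h2]
  have h3 : ∀ a b : ℂ, (((Real.log n : ℝ) : ℂ) - (starRingEnd ℂ) a) / (starRingEnd ℂ) b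
      = (starRingEnd ℂ) ((((Real.log n : ℝ) : ℂ) - a) / b) := by
    intro a b; rw [map_div₀, map_sub, Complex.conj_ofReal]
  have h4 : ∀ b : ℂ, 1 / (starRingEnd ℂ) b = (starRingEnd ℂ) (1 / b) := by
    intro b; simp
  rw [h3, h4, Complex.conj_im, Complex.conj_im, sub_div, Complex.sub_im,
    show ∀ b : ℂ, ((Real.log n : ℝ) : ℂ) / b = ((Real.log n : ℝ) : ℂ) * (1 / b) from
      fun b => by ring, Complex.im_ofReal_mul]
  ring

theorem abs_im_log_div_le (hn : 1 ≤ n) {s : ℝ} (hs : 0 < s) :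
    |(Complex.log (n + s * Complex.I) / (n + s * Complex.I)).im|
      ≤ s * ((1 + Real.log n) / n ^ 2) := by
  have hlog := Real.log_natCast_nonneg n
  rw [im_log_div_eq hn]
  refine (abs_sub _ _).trans ?_
  rw [abs_mul, abs_of_nonneg hlog]
  have h1 := abs_im_log_sub_log_div_le hn hs
  have h2 := mul_le_mul_of_nonneg_left (abs_im_one_div_le hn hs) hlog
  refine (add_le_add h1 h2).trans_eq ?_
  ring

/-- The Abel–Plana correction `2 ∫ Im (log z / z) / (exp (2πs) - 1)`, `z = n + is`. -/
noncomputable def logDivCorrection (n : ℕ) : ℝ :=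
  ∫ s in Ioi (0 : ℝ), (Complex.log (n + s * Complex.I) / (n + s * Complex.I)).im * abelWeight s

theorem tendsto_logDivCorrection : Tendsto logDivCorrection atTop (𝓝 0) := by
  have h1 : Tendsto (fun n : ℕ => 1 / (n : ℝ) + Real.log n / n) atTop (𝓝 0) := by
    have h2 := (Real.isLittleO_log_id_atTop.tendsto_div_nhds_zero).comp tendsto_natCast_atTop_atTop
    simpa using tendsto_one_div_atTop_nhds_zero_nat.add h2
  refine squeeze_zero_norm' ?_ h1
  filter_upwards [eventually_ge_atTop 1] with n hn
  have hn' : (1 : ℝ) ≤ n := by exact_mod_cast hn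
  have hlog := Real.log_natCast_nonneg n
  refine (abs_integral_mul_abelWeight_le (B := (1 + Real.log n) / n ^ 2) (by positivity)
    fun s hs => abs_im_log_div_le hn hs).trans ?_
  rw [← add_div]
  refine div_le_div_of_nonneg_left (by positivity) (by positivity) ?_
  nlinarith

theorem integrableOn_im_log_div (hn : 1 ≤ n) : IntegrableOn (fun s : ℝ =>
    (Complex.log (n + s * Complex.I) / (n + s * Complex.I)).im * abelWeight s) (Ioi 0) :=
  integrableOn_mul_abelWeight (B := (1 + Real.log n) / n ^ 2)
    (div_nonneg (add_nonneg zero_le_one (Real.log_natCast_nonneg n)) (by positivity))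
    (by fun_prop) fun _ hs => abs_im_log_div_le hn hs

theorem norm_log_div_le {z : ℂ} (hz : 1 ≤ z.re) : ‖Complex.log z / z‖ ≤ 1 + Real.pi := by
  have h1 : 1 ≤ ‖z‖ := hz.trans ((le_abs_self _).trans (Complex.abs_re_le_norm z))
  have h2 : ‖Complex.log z‖ ≤ Real.log ‖z‖ + Real.pi := by
    refine (Complex.norm_le_abs_re_add_abs_im _).trans (add_le_add ?_ ?_)
    · rw [Complex.log_re, abs_of_nonneg (Real.log_nonneg h1)]
    · rw [Complex.log_im]
      exact Complex.abs_arg_le_pi z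
  have h3 := Real.log_le_sub_one_of_pos (zero_lt_one.trans_le h1)
  rw [norm_div, div_le_iff₀ (zero_lt_one.trans_le h1)]
  nlinarith [Real.pi_pos]

theorem logDivCorrection_sub_succ (hn : 1 ≤ n) :
    logDivCorrection n - logDivCorrection (n + 1)
      = Real.log (n + 1) ^ 2 / 2 - Real.log n ^ 2 / 2
        - (Real.log n / n + Real.log (n + 1) / (n + 1)) / 2 := by
  have hn' : (1 : ℝ) ≤ n := by exact_mod_cast hn
  have hreal : ∀ x : ℝ, 0 ≤ x → Complex.log x / x = ((Real.log x / x : ℝ) : ℂ) := by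
    intro x hx
    rw [← Complex.ofReal_log hx, ← Complex.ofReal_div]
  have key := integral_strip (f := fun z => Complex.log z / z) (a := n) (C := 1 + Real.pi)
    (fun z h0 _ _ => ?_) (fun z h0 _ h2 => ?_) (fun x h0 _ => ?_)
  · have hint : ∫ x in (n : ℝ)..(n + 1), (Complex.log x / x).re
        = ∫ x in (n : ℝ)..(n + 1), Real.log x / x := by
      refine intervalIntegral.integral_congr fun x hx => ?_
      rw [uIcc_of_le (by linarith)] at hx
      simp only [hreal x (by linarith [hx.1]), Complex.ofReal_re]
    have hn1 := hreal (n + 1) (by linarith)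
    push_cast at hn1
    rw [hint, integral_log_div (by linarith) (by linarith)] at key
    simp only [Complex.ofReal_natCast, hn1] at key
    norm_cast at key
    rw [logDivCorrection, logDivCorrection,
      ← integral_sub (integrableOn_im_log_div hn) (integrableOn_im_log_div (Nat.le_add_left 1 n))]
    simp only [← sub_mul]
    push_cast at key ⊢
    exact key
  · have hz : z ∈ Complex.slitPlane := Or.inl (by linarith)
    exact (Complex.differentiableAt_log hz).div differentiableAt_id (Complex.slitPlane_ne_zero hz)
  · refine (norm_log_div_le (hn'.trans h0)).trans (le_mul_of_one_le_right ?_ (Real.one_le_exp h2))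
    linarith [Real.pi_pos]
  · simp only [hreal x (by linarith), Complex.ofReal_im]

theorem stieltjesOneSeq_eq (hn : 1 ≤ n) :
    stieltjesOneSeq n = Real.log n / (2 * n) + stieltjesOne + logDivCorrection n := by
  set D : ℕ → ℝ := fun m =>
    stieltjesOneSeq m - Real.log m / m / 2 - logDivCorrection m with hD
  -- The half-strip identity says that `D` is constant from index `1` on; its limit is `γ₁`, since
  -- both subtracted terms tend to zero.
  have hstep : ∀ m, D (m + 1 + 1) = D (m + 1) := by
    intro m
    have h := logDivCorrection_sub_succ (Nat.le_add_left 1 m)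
    simp only [hD, stieltjesOneSeq]
    rw [Finset.sum_Icc_succ_top (by omega)]
    push_cast at h ⊢
    linarith
  have hconst : ∀ m, D (m + 1) = D 1 := by
    intro m
    induction m with
    | zero => rfl
    | succ m ih => rw [hstep, ih]
  have hlim : Tendsto (fun m => D (m + 1)) atTop (𝓝 stieltjesOne) := by
    have h2 := (Real.isLittleO_log_id_atTop.tendsto_div_nhds_zero).comp tendsto_natCast_atTop_atTop
    have h3 := (tendsto_stieltjesOneSeq.sub (h2.div_const 2)).sub tendsto_logDivCorrection
    rw [zero_div, sub_zero, sub_zero] at h3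
    exact (tendsto_add_atTop_iff_nat 1).2 h3
  have h1 : D 1 = stieltjesOne :=
    tendsto_nhds_unique (tendsto_const_nhds.congr fun m => (hconst m).symm) hlim
  obtain ⟨m, rfl⟩ : ∃ m, n = m + 1 := ⟨n - 1, by omega⟩
  have h4 := (hconst m).trans h1
  simp only [hD] at h4
  rw [mul_comm, ← div_div]
  linarith

theorem logDivCorrection_eq (hn : 1 ≤ n) : logDivCorrection n
    = ∑' k, coeffA k / risingProd n k + Real.log n * ∑' k, coeffB k / risingProd n k := by
  have hm : Measurable fun s : ℝ =>
      ((Complex.log n - Complex.log (n - s * Complex.I)) / (n - s * Complex.I)).im := by fun_prop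
  have hA := integrableOn_mul_abelWeight (B := 1 / n ^ 2) (by positivity) hm
    fun s hs => (abs_im_log_sub_log_div_le hn hs).trans_eq (by ring)
  have hm' : Measurable fun s : ℝ => (1 / ((n : ℂ) - s * Complex.I)).im := by fun_prop
  have hB := integrableOn_mul_abelWeight (B := 1 / n ^ 2) (by positivity) hm'
    fun s hs => (abs_im_one_div_le hn hs).trans_eq (by ring)
  rw [(hasSum_coeffA hn).tsum_eq, (hasSum_coeffB hn).tsum_eq, mul_neg, ← sub_eq_add_neg,
    ← integral_const_mul, ← integral_sub hA (hB.const_mul _), logDivCorrection]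
  refine integral_congr_ae (ae_of_all _ fun s => ?_)
  simp only [im_log_div_eq hn]
  ring

/-! ### The leading coefficients. -/

theorem bernoulli_four : bernoulli 4 = -1 / 30 := by
  rw [bernoulli_eq_bernoulli'_of_ne_one (by norm_num), bernoulli'_four]

theorem bernoulli_three : bernoulli 3 = 0 := bernoulli_eq_zero_of_odd (by decide) (by norm_num)

theorem bernoulli_five : bernoulli 5 = 0 := bernoulli_eq_zero_of_odd (by decide) (by norm_num)

theorem coeffA_one : coeffA 1 = 1 / 12 := by
  norm_num [coeffA, stirlingS, Nat.stirlingFirst, Finset.sum_Icc_succ_top, Nat.factorial]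

theorem coeffA_two : coeffA 2 = 1 / 12 := by
  norm_num [coeffA, stirlingS, Nat.stirlingFirst, Finset.sum_Icc_succ_top, Nat.factorial, bernoulli_three]

theorem coeffA_three : coeffA 3 = 109 / 720 := by
  norm_num [coeffA, stirlingS, Nat.stirlingFirst, Finset.sum_Icc_succ_top, Nat.factorial, bernoulli_three, bernoulli_four]

theorem coeffA_four : coeffA 4 = 49 / 120 := by
  norm_num [coeffA, stirlingS, Nat.stirlingFirst, Finset.sum_Icc_succ_top, Nat.factorial, bernoulli_three, bernoulli_four,
    bernoulli_five]

theorem coeffB_one : coeffB 1 = -(1 / 12) := by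
  norm_num [coeffB, stirlingS, Nat.stirlingFirst, Finset.sum_Icc_succ_top]

theorem coeffB_two : coeffB 2 = -(1 / 12) := by
  norm_num [coeffB, stirlingS, Nat.stirlingFirst, Finset.sum_Icc_succ_top, bernoulli_three]

theorem coeffB_three : coeffB 3 = -(19 / 120) := by
  norm_num [coeffB, stirlingS, Nat.stirlingFirst, Finset.sum_Icc_succ_top, bernoulli_three, bernoulli_four]

theorem coeffB_four : coeffB 4 = -(9 / 20) := by
  norm_num [coeffB, stirlingS, Nat.stirlingFirst, Finset.sum_Icc_succ_top, bernoulli_three, bernoulli_four,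
    bernoulli_five]

end SecondLogSum

/-- The series are indexed by `k = j + 1`, `j : ℕ`. The last eight equations are the displayed
leading terms of the two series. -/
theorem mainTheorem9 (n : ℕ) (hn : 1 ≤ n) :
    Summable (fun j : ℕ => SecondLogSum.coeffA (j + 1) / SecondLogSum.risingProd n (j + 1)) ∧
    Summable (fun j : ℕ => SecondLogSum.coeffB (j + 1) / SecondLogSum.risingProd n (j + 1)) ∧
    ((∑ k ∈ Finset.Icc 1 n, Real.log k / k) =
      1 / 2 * Real.log n ^ 2 + Real.log n / (2 * n) + SecondLogSum.stieltjesOne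
        + ∑' j : ℕ, SecondLogSum.coeffA (j + 1) / SecondLogSum.risingProd n (j + 1)
        + Real.log n *
          ∑' j : ℕ, SecondLogSum.coeffB (j + 1) / SecondLogSum.risingProd n (j + 1)) ∧
    (SecondLogSum.coeffA 1 = 1 / 12 ∧ SecondLogSum.coeffA 2 = 1 / 12 ∧
      SecondLogSum.coeffA 3 = 109 / 720 ∧ SecondLogSum.coeffA 4 = 49 / 120) ∧
    (SecondLogSum.coeffB 1 = -(1 / 12) ∧ SecondLogSum.coeffB 2 = -(1 / 12) ∧
      SecondLogSum.coeffB 3 = -(19 / 120) ∧ SecondLogSum.coeffB 4 = -(9 / 20)) := by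
  have hA := (SecondLogSum.hasSum_coeffA hn).summable
  have hB := (SecondLogSum.hasSum_coeffB hn).summable
  refine ⟨hA.comp_injective (add_left_injective 1),
    hB.comp_injective (add_left_injective 1), ?_, ?_, ?_⟩
  · have h1 := SecondLogSum.stieltjesOneSeq_eq hn
    rw [SecondLogSum.logDivCorrection_eq hn, hA.tsum_eq_zero_add, hB.tsum_eq_zero_add,
      SecondLogSum.stieltjesOneSeq] at h1
    -- The expansions start at `k = 0`, where both coefficients are empty sums, so the series may
    -- start at `k = 1`.
    have hA0 : SecondLogSum.coeffA 0 = 0 := by simp [SecondLogSum.coeffA]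
    have hB0 : SecondLogSum.coeffB 0 = 0 := by simp [SecondLogSum.coeffB]
    simp only [hA0, hB0, zero_div, zero_add] at h1
    linarith
  · exact ⟨SecondLogSum.coeffA_one, SecondLogSum.coeffA_two, SecondLogSum.coeffA_three,
      SecondLogSum.coeffA_four⟩
  · exact ⟨SecondLogSum.coeffB_one, SecondLogSum.coeffB_two, SecondLogSum.coeffB_three,
      SecondLogSum.coeffB_four⟩
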